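/- Let $K$ be a unital commutative $\mathbb Q$-algebra, $z=(z_1,\dots,z_n)$ commutative or noncommutative free variables, $t$ a central formal parameter, and write $K\langle\langle z\rangle\rangle$ and $K[[t]]\langle\langle z\rangle\rangle$ for the algebras of formal power series in $z$ (in the commutative case, $K[[z]]$ and $K[[t]][[z]]$). Let $F_t$ be an automorphism of $K[[t]]\langle\langle z\rangle\rangle$ over $K[[t]]$ of the form $F_t(z)=z-tH(z)$, where $H\in K\langle\langle z\rangle\rangle^{\times n}$ has zero constant term, and let $G_t=F_t^{-1}$. For a tuple $u=(u_1,\dots,u_n)$ let $[u\,\partial/\partial z]$ denote the derivation with $z_i\mapsto u_i$. Define $K$-linear operators $\lambda_m,s_m,\phi_m,\xi_m$ on $K\langle\langle z\rangle\rangle$ by $$f(t)=\sum_{m\ge0}t^m\lambda_m,\quad g(t)=\sum_{m\ge0}t^m s_m,\quad d(t)=\sum_{m\ge1}\frac{t^m}{m}\phi_m,\quad \Big[\frac{\partial H_t}{\partial t}(G_t)\frac{\partial}{\partial z}\Big]=\sum_{m\ge1}t^{m-1}\xi_m,$$ where $H_t(z)=z-F_t(z)=tH(z)$, $f(-t)u=u(F_t)$,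 $g(t)u=u(G_t)$, $d(0)=0$ and $e^{d(t)}=g(t)$. Define $C_1=H$ and $C_m=[C_{m-1}\,\partial/\partial z]H$ for $m\ge2$. For $m\geq 1$ let $\mathcal C_m$ be the set of compositions $I=(i_1,\dots,i_k)$ of $m$; put $\ell(I)=k$, $fp(I)=i_1$, $lp(I)=i_k$, $\bar I=(i_k,\dots,i_1)$, $\pi_u(I)=\prod_{j=1}^k(i_1+\cdots+i_j)$, $sp(I)=k!\,i_1\cdots i_k$, and $w^I=w_{i_1}\cdots w_{i_k}$ for a sequence of operators $w$. Write $I\succeq J$ if $I$ is a refinement of $J=(j_1,\dots,j_r)$, i.e. $I$ is the concatenation of compositions $I_1,\dots,I_r$ of $j_1,\dots,j_r$; then $\pi_u(I,J)=\prod_a\pi_u(I_a)$ and $sp(I,J)=\prod_a sp(I_a)$. Then for every $m\ge1$: $$C_m(z)=(-1)^m\sum_{I\in\mathcal C_m}(-1)^{\ell(I)}fp(I)\,\lambda^I z,$$ $$C_m(z)=-\sum_{I\in\mathcal C_m}(-1)^{\ell(I)}lp(I)\,s^I z,$$ $$C_m(z)=-\sum_{I\in\mathcal C_m}\Big(\sum_{I\succeq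 J}(-1)^{\ell(J)}\frac{lp(J)}{sp(I,J)}\Big)\phi^I z,$$ $$C_m(z)=\sum_{I\in\mathcal C_m}\Big(\sum_{I\succeq J}(-1)^{\ell(J)-1}\frac{lp(J)}{\pi_u(\bar I,\bar J)}\Big)\xi^I z.$$ In particular, when the variables $z$ are commutative and $JH=(\partial H_i/\partial z_j)$, the same four formulas hold with $(JH)^{m-1}H$ in place of $C_m(z)$. -/

import Mathlib

open scoped PowerSeries BigOperators

noncomputable section

/-! ## Compositions -/

namespace NCSF

/-- First part of a composition (given as the list of its parts). -/
def fp (I : List ℕ) : ℕ := I.headD 0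

/-- Last part of a composition. -/
def lp (I : List ℕ) : ℕ := I.getLastD 0

/-- `π_u(i₁, …, i_k) = ∏_{j=1}^k (i₁ + ⋯ + i_j)`. -/
def piU (I : List ℕ) : ℕ := ∏ j ∈ Finset.range I.length, (I.take (j + 1)).sum

/-- `sp(i₁, …, i_k) = k! · i₁ ⋯ i_k`. -/
def sp (I : List ℕ) : ℕ := I.length.factorial * I.prod

variable {m : ℕ}

/-- `L = [I₁, I₂, …]` cuts `I` into consecutive pieces, one for each part of `J`, the entries of
the `a`-th piece summing to the `a`-th part of `J`. -/
def IsCutting (I J : Composition m) (L : List (List ℕ)) : Prop :=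
  L.flatten = I.blocks ∧ L.map List.sum = J.blocks

/-- `I ⪰ J`: the composition `I` is a refinement of the composition `J`. -/
def Refines (I J : Composition m) : Prop := ∃ L, IsCutting I J L

open Classical in
/-- The pieces `I₁, …, I_{ℓ(J)}` of a refinement `I ⪰ J` (see `pieces_eq`). -/
def pieces (I J : Composition m) : List (List ℕ) :=
  if h : Refines I J then h.choose else []

open Classical in
/-- The finite set of all compositions `J` with `I ⪰ J`. -/
def coarsenings (I : Composition m) : Finset (Composition m) :=
  Finset.univ.filter fun J => Refines I J

/-- `π_u(I, J) = ∏_a π_u(I_a)` for `I ⪰ J`. -/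
def piU₂ (I J : Composition m) : ℕ := ((pieces I J).map piU).prod

/-- `sp(I, J) = ∏_a sp(I_a)` for `I ⪰ J`. -/
def sp₂ (I J : Composition m) : ℕ := ((pieces I J).map sp).prod

theorem cutting_unique : ∀ (L L' : List (List ℕ)), L.flatten = L'.flatten →
    L.map List.sum = L'.map List.sum → (∀ x ∈ L.flatten, 0 < x) →
    (∀ s ∈ L.map List.sum, 0 < s) → L = L'
  | [], [], _, _, _, _ => rfl
  | [], _ :: _, _, h, _, _ => by simp at h
  | _ :: _, [], _, h, _, _ => by simp at h
  | p :: L, q :: L', hf, hs, hpos, hs0 => by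
    have aux : ∀ (p q r s : List ℕ), p ++ r = q ++ s → p.sum = q.sum →
        (∀ x ∈ p ++ r, 0 < x) → p = q := by
      intro p
      induction p with
      | nil =>
        intro q r s h1 h2 h3
        cases q with
        | nil => rfl
        | cons a q =>
          have : 0 < a := h3 a (by rw [h1]; simp)
          simp at h2
          omega
      | cons b p ih =>
        intro q r s h1 h2 h3
        cases q with
        | nil =>
          have : 0 < b := h3 b (by simp)
          simp at h2
          omega
        | cons a q =>
          simp only [List.cons_append, List.cons.injEq] at h1
          obtain ⟨rfl, h1⟩ := h1
          simp only [List.sum_cons, Nat.add_left_cancel_iff] at h2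
          rw [ih q r s h1 h2 (fun x hx => h3 x (by
            rw [List.cons_append]; exact List.mem_cons_of_mem _ hx))]
    simp only [List.flatten_cons] at hf hpos
    simp only [List.map_cons, List.cons.injEq] at hs
    have hpq : p = q := aux p q _ _ hf hs.1 hpos
    subst hpq
    rw [cutting_unique L L' (List.append_cancel_left hf) hs.2
      (fun x hx => hpos x (List.mem_append_right _ hx))
      (fun s h => hs0 s (by
        rw [List.map_cons]; exact List.mem_cons_of_mem _ h))]

/-- A refinement has only one cutting, so `pieces` is the list of its pieces. -/
theorem pieces_eq {I J : Composition m} {L : List (List ℕ)} (h : IsCutting I J L) :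
    pieces I J = L := by
  have hR : Refines I J := ⟨L, h⟩
  have h' : IsCutting I J (pieces I J) := by
    unfold pieces
    rw [dif_pos hR]
    exact hR.choose_spec
  refine cutting_unique _ _ (h'.1.trans h.1.symm) (h'.2.trans h.2.symm) ?_ ?_
  · rw [h'.1]
    exact fun x hx => I.blocks_pos hx
  · rw [h'.2]
    exact fun x hx => J.blocks_pos hx

/-- `w^I = w_{i₁} w_{i₂} ⋯ w_{i_k}`. -/
def cpow {E : Type*} [Monoid E] (w : ℕ → E) (I : Composition m) : E := (I.blocks.map w).prod

/-! ## Exponential and logarithm of power series in a central variable -/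

section ExpLog

variable (K : Type*) {E : Type*} [CommRing K] [Algebra ℚ K] [Ring E] [Algebra K E]

/-- `e^d = ∑_k d^k / k!` for a power series `d` with zero constant term (the terms `k > m` do not
contribute to the coefficient of `t^m`). -/
def expSeries (d : E⟦X⟧) : E⟦X⟧ :=
  PowerSeries.mk fun m => ∑ k ∈ Finset.range (m + 1),
    algebraMap ℚ K (1 / (k.factorial : ℚ)) • PowerSeries.coeff m (d ^ k)

variable {K}

theorem coeff_pow_eq_zero {d : E⟦X⟧} (hd : PowerSeries.coeff 0 d = 0) (k : ℕ) :
    ∀ j < k, PowerSeries.coeff j (d ^ k) = 0 := by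
  induction k with
  | zero => intro j hj; omega
  | succ k ih =>
    intro j hj
    rw [pow_succ, PowerSeries.coeff_mul]
    refine Finset.sum_eq_zero fun p hp => ?_
    rw [Finset.HasAntidiagonal.mem_antidiagonal] at hp
    rcases Nat.eq_zero_or_pos p.2 with h | h
    · rw [h, hd, mul_zero]
    · rw [ih p.1 (by omega), zero_mul]

theorem coeff_pow_congr {d e : E⟦X⟧} (hd : PowerSeries.coeff 0 d = 0)
    (he : PowerSeries.coeff 0 e = 0) {m : ℕ}
    (h : ∀ j < m, PowerSeries.coeff j d = PowerSeries.coeff j e) (k : ℕ) :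
    ∀ j < m + k, PowerSeries.coeff j (d ^ (k + 1)) = PowerSeries.coeff j (e ^ (k + 1)) := by
  induction k with
  | zero => intro j hj; simpa using h j (by omega)
  | succ k ih =>
    intro j hj
    rw [pow_succ d, pow_succ e, PowerSeries.coeff_mul, PowerSeries.coeff_mul]
    refine Finset.sum_congr rfl fun p hp => ?_
    rw [Finset.HasAntidiagonal.mem_antidiagonal] at hp
    rcases Nat.eq_zero_or_pos p.2 with h0 | h0
    · rw [h0, hd, he]
      simp
    · rcases lt_or_ge p.2 m with h1 | h1
      · rw [h _ h1, ih p.1 (by omega)]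
      · rw [coeff_pow_eq_zero hd _ p.1 (by omega), coeff_pow_eq_zero he _ p.1 (by omega)]
        simp

theorem coeff_expSeries {d : E⟦X⟧} {m : ℕ} (hm : 0 < m) :
    PowerSeries.coeff m (expSeries K d) = PowerSeries.coeff m d +
      ∑ k ∈ Finset.range (m - 1), algebraMap ℚ K (1 / ((k + 2).factorial : ℚ)) •
        PowerSeries.coeff m (d ^ (k + 2)) := by
  obtain ⟨m, rfl⟩ : ∃ n, m = n + 1 := ⟨m - 1, by omega⟩
  rw [expSeries, PowerSeries.coeff_mk, Finset.sum_range_succ', Finset.sum_range_succ']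
  have h : ∀ k : ℕ, k + 1 + 1 = k + 2 := fun _ => rfl
  simp only [h, zero_add, pow_one, pow_zero, PowerSeries.coeff_one, Nat.add_one_ne_zero, if_false,
    smul_zero, add_zero, Nat.factorial_one, Nat.cast_one, div_one, map_one, one_smul,
    Nat.add_sub_cancel]
  exact add_comm _ _

variable (K) in
/-- The recursion for the coefficients of the logarithm. -/
def logCoeff (g : E⟦X⟧) (m : ℕ) : E :=
  if m = 0 then 0 else
    PowerSeries.coeff m g -
      ∑ k ∈ Finset.range (m - 1), algebraMap ℚ K (1 / ((k + 2).factorial : ℚ)) •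
        PowerSeries.coeff m
          ((PowerSeries.mk fun j => if _h : j < m then logCoeff g j else 0) ^ (k + 2))

/-- For `g(0) = 1` there is exactly one `d` with `d(0) = 0` and `e^d = g`. -/
theorem existsUnique_log (g : E⟦X⟧) (hg : PowerSeries.coeff 0 g = 1) :
    ∃! d : E⟦X⟧, PowerSeries.coeff 0 d = 0 ∧ expSeries K d = g := by
  have h0 : PowerSeries.coeff 0 (PowerSeries.mk (logCoeff K g)) = 0 := by
    rw [PowerSeries.coeff_mk, logCoeff, if_pos rfl]
  have key : ∀ d : E⟦X⟧, PowerSeries.coeff 0 d = 0 → ∀ m, 0 < m →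
      (∀ j < m, PowerSeries.coeff j d = logCoeff K g j) →
      PowerSeries.coeff m (expSeries K d) =
        PowerSeries.coeff m d + (PowerSeries.coeff m g - logCoeff K g m) := by
    intro d hd m hm h
    rw [coeff_expSeries hm, logCoeff, if_neg hm.ne', sub_sub_cancel]
    congr 1
    refine Finset.sum_congr rfl fun k _ => ?_
    congr 1
    refine coeff_pow_congr (m := m) hd ?_ ?_ (k + 1) m (by omega)
    · rw [PowerSeries.coeff_mk, dif_pos hm, logCoeff, if_pos rfl]
    · intro j hj
      rw [PowerSeries.coeff_mk, dif_pos hj, h j hj]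
  refine ⟨PowerSeries.mk (logCoeff K g), ⟨h0, ?_⟩, ?_⟩
  · ext m
    rcases Nat.eq_zero_or_pos m with rfl | hm
    · simp [expSeries, hg]
    · rw [key _ h0 m hm fun j _ => PowerSeries.coeff_mk _ _, PowerSeries.coeff_mk]
      abel
  · rintro d ⟨hd, rfl⟩
    ext m
    rw [PowerSeries.coeff_mk]
    induction m using Nat.strong_induction_on with
    | _ m ih =>
      rcases Nat.eq_zero_or_pos m with rfl | hm
      · rw [hd, logCoeff, if_pos rfl]
      · have := key d hd m hm ih
        rw [← add_sub_assoc, eq_sub_iff_add_eq, add_comm, add_right_cancel_iff] at this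
        exact this.symm

open Classical in
variable (K) in
/-- The logarithm of `g`: the unique `d` with `d(0) = 0` and `e^d = g`, if `g(0) = 1`. -/
def logSeries (g : E⟦X⟧) : E⟦X⟧ :=
  if h : PowerSeries.coeff 0 g = 1 then (existsUnique_log (K := K) g h).choose else 0

theorem logSeries_spec {g : E⟦X⟧} (h : PowerSeries.coeff 0 g = 1) :
    PowerSeries.coeff 0 (logSeries K g) = 0 ∧ expSeries K (logSeries K g) = g := by
  rw [logSeries, dif_pos h]
  exact (existsUnique_log (K := K) g h).choose_spec.1

end ExpLog

end NCSF

/-! ## Formal power series in noncommutative variables -/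

/-- `R⟨⟨z⟩⟩`: formal power series in free noncommutative variables `z_i`, `i : σ`, over `R`; the
list `[i₁, …, i_k]` stands for the monomial `z_{i₁} ⋯ z_{i_k}`. -/
def NCSeries (σ R : Type*) : Type _ := List σ → R

namespace NCSeries

variable {σ R S : Type*}

@[ext] theorem ext {a b : NCSeries σ R} (h : ∀ w : List σ, a w = b w) : a = b := funext h

instance [AddCommGroup R] : AddCommGroup (NCSeries σ R) :=
  inferInstanceAs (AddCommGroup (List σ → R))

instance [Semiring S] [AddCommGroup R] [Module S R] : Module S (NCSeries σ R) :=
  inferInstanceAs (Module S (List σ → R))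

instance {T : Type*} [Semiring S] [Semiring T] [SMul S T] [AddCommGroup R] [Module S R]
    [Module T R] [IsScalarTower S T R] : IsScalarTower S T (NCSeries σ R) :=
  inferInstanceAs (IsScalarTower S T (List σ → R))

@[simp] theorem add_apply [AddCommGroup R] (a b : NCSeries σ R) (w : List σ) :
    (a + b) w = a w + b w := rfl

@[simp] theorem zero_apply [AddCommGroup R] (w : List σ) : (0 : NCSeries σ R) w = 0 := rfl

@[simp] theorem smul_apply [Semiring S] [AddCommGroup R] [Module S R] (c : S)
    (a : NCSeries σ R) (w : List σ) : (c • a) w = c • a w := rfl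

theorem sum_apply [AddCommGroup R] {ι : Type*} (s : Finset ι) (f : ι → NCSeries σ R)
    (w : List σ) : (∑ i ∈ s, f i) w = ∑ i ∈ s, f i w :=
  Finset.sum_apply (M := fun _ : List σ => R) w s f

variable [CommRing R]

instance : One (NCSeries σ R) :=
  ⟨fun w => match w with
    | [] => 1
    | _ :: _ => 0⟩

/-- The Cauchy product: the coefficient of `w` is the sum over all factorizations `w = x y`. -/
instance : Mul (NCSeries σ R) :=
  ⟨fun a b w => ∑ k ∈ Finset.range (w.length + 1), a (w.take k) * b (w.drop k)⟩

@[simp] theorem one_nil : (1 : NCSeries σ R) [] = 1 := rfl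

@[simp] theorem one_cons (j : σ) (w : List σ) : (1 : NCSeries σ R) (j :: w) = 0 := rfl

theorem mul_apply (a b : NCSeries σ R) (w : List σ) :
    (a * b) w = ∑ k ∈ Finset.range (w.length + 1), a (w.take k) * b (w.drop k) := rfl

/-- Left division by a variable. -/
def lq (j : σ) : NCSeries σ R →ₗ[R] NCSeries σ R where
  toFun a := fun w => a (j :: w)
  map_add' _ _ := rfl
  map_smul' _ _ := rfl

@[simp] theorem lq_apply (j : σ) (a : NCSeries σ R) (w : List σ) : lq j a w = a (j :: w) := rfl

theorem mul_nil (a b : NCSeries σ R) : (a * b) [] = a [] * b [] := by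
  simp [mul_apply]

theorem mul_cons (a b : NCSeries σ R) (j : σ) (w : List σ) :
    (a * b) (j :: w) = a [] * b (j :: w) + (lq j a * b) w := by
  rw [mul_apply, mul_apply, List.length_cons, Finset.sum_range_succ', add_comm]
  simp

theorem series_add_mul (a b c : NCSeries σ R) : (a + b) * c = a * c + b * c := by
  ext w
  simp [mul_apply, add_mul, Finset.sum_add_distrib]

theorem series_mul_add (a b c : NCSeries σ R) : a * (b + c) = a * b + a * c := by
  ext w
  simp [mul_apply, mul_add, Finset.sum_add_distrib]

theorem series_smul_mul (r : R) (a b : NCSeries σ R) : (r • a) * b = r • (a * b) := by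
  ext w
  simp [mul_apply, Finset.mul_sum, mul_assoc]

theorem series_mul_smul (r : R) (a b : NCSeries σ R) : a * (r • b) = r • (a * b) := by
  ext w
  simp [mul_apply, Finset.mul_sum, mul_left_comm]

theorem lq_mul (j : σ) (a b : NCSeries σ R) : lq j (a * b) = a [] • lq j b + lq j a * b := by
  ext w
  simp [mul_cons]

theorem series_mul_assoc (a b c : NCSeries σ R) : a * b * c = a * (b * c) := by
  ext w
  induction w generalizing a with
  | nil => simp [mul_nil, mul_assoc]
  | cons j w ih =>
    rw [mul_cons, mul_cons a, mul_nil, lq_mul, series_add_mul, series_smul_mul, add_apply, smul_apply, ih,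
      mul_cons b]
    simp only [smul_eq_mul]
    ring

theorem series_one_mul (a : NCSeries σ R) : 1 * a = a := by
  ext w
  cases w with
  | nil => simp [mul_nil]
  | cons j w =>
    have : lq j (1 : NCSeries σ R) = 0 := rfl
    rw [mul_cons, this]
    simp [mul_apply]

theorem series_mul_one (a : NCSeries σ R) : a * 1 = a := by
  ext w
  induction w generalizing a with
  | nil => simp [mul_nil]
  | cons j w ih => rw [mul_cons, ih]; simp

instance : Ring (NCSeries σ R) :=
  { (inferInstance : AddCommGroup (NCSeries σ R)) with
    mul := (· * ·)
    one := 1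
    left_distrib := series_mul_add
    right_distrib := series_add_mul
    zero_mul := fun a => by ext w; simp [mul_apply]
    mul_zero := fun a => by ext w; simp [mul_apply]
    mul_assoc := series_mul_assoc
    one_mul := series_one_mul
    mul_one := series_mul_one }

instance : Algebra R (NCSeries σ R) :=
  Algebra.ofModule series_smul_mul series_mul_smul

/-- The variable `z_i`. -/
def X [DecidableEq σ] (i : σ) : NCSeries σ R := fun w => if w = [i] then 1 else 0

/-- The derivation `[u ∂/∂z]`, which replaces, in all possible ways, one variable `z_i` of a
monomial by the series `u_i`: the monomial `x z_i y` contributes `x u_i y`, so the coefficient of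
`w` in the result is a sum over all factorizations `w = x p y` and all `i`. -/
def bracket [Fintype σ] (u : σ → NCSeries σ R) : NCSeries σ R →ₗ[R] NCSeries σ R where
  toFun a := fun w => ∑ k ∈ Finset.range (w.length + 1), ∑ l ∈ Finset.range (w.length - k + 1),
    ∑ i, u i ((w.drop k).take l) * a (w.take k ++ i :: (w.drop k).drop l)
  map_add' a b := by
    ext w
    simp only [add_apply, mul_add, Finset.sum_add_distrib]
    rfl
  map_smul' r a := by
    ext w
    change _ = r * _
    simp only [smul_apply, smul_eq_mul, Finset.mul_sum, mul_left_comm]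

section bracket

variable [Fintype σ] (u : σ → NCSeries σ R)

theorem bracket_apply (a : NCSeries σ R) (w : List σ) :
    bracket u a w = ∑ k ∈ Finset.range (w.length + 1), ∑ l ∈ Finset.range (w.length - k + 1),
      ∑ i, u i ((w.drop k).take l) * a (w.take k ++ i :: (w.drop k).drop l) := rfl

theorem bracket_nil (a : NCSeries σ R) : bracket u a [] = (∑ i, u i * lq i a) [] := by
  simp [bracket_apply, sum_apply, mul_apply]

theorem bracket_cons (a : NCSeries σ R) (j : σ) (w : List σ) :
    bracket u a (j :: w) = (∑ i, u i * lq i a) (j :: w) + bracket u (lq j a) w := by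
  rw [bracket_apply, List.length_cons, Finset.sum_range_succ', add_comm]
  congr 1
  · simp only [sum_apply, mul_apply]
    rw [Finset.sum_comm]
    simp
  · simp [bracket_apply]

/-- The Leibniz rule. -/
theorem bracket_mul (a b : NCSeries σ R) :
    bracket u (a * b) = bracket u a * b + a * bracket u b := by
  have h1 : ∀ a b : NCSeries σ R, ∑ i, u i * lq i (a * b) =
      a [] • (∑ i, u i * lq i b) + (∑ i, u i * lq i a) * b := by
    intro a b
    rw [Finset.smul_sum, Finset.sum_mul, ← Finset.sum_add_distrib]
    refine Finset.sum_congr rfl fun i _ => ?_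
    rw [lq_mul, mul_add, mul_smul_comm, mul_assoc]
  have h2 : ∀ (a : NCSeries σ R) (j : σ), lq j (bracket u a) =
      lq j (∑ i, u i * lq i a) + bracket u (lq j a) := by
    intro a j
    ext w
    rw [add_apply, lq_apply, lq_apply, bracket_cons]
  ext w
  induction w generalizing a with
  | nil =>
    rw [add_apply, mul_nil, mul_nil, bracket_nil, h1, bracket_nil, bracket_nil, add_apply,
      smul_apply, mul_nil, smul_eq_mul]
    ring
  | cons j w ih =>
    rw [add_apply, mul_cons, mul_cons, bracket_cons, h1, bracket_nil, bracket_cons, h2, add_mul,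
      lq_mul, map_add, map_smul]
    simp only [add_apply, smul_apply, ih, mul_cons, smul_eq_mul]
    ring

/-- `[u ∂/∂z]` maps `z_i` to `u_i`. -/
theorem bracket_X [DecidableEq σ] (i : σ) : bracket u (X i) = u i := by
  have h1 : ∀ j, lq j (X i : NCSeries σ R) = if j = i then 1 else 0 := by
    intro j
    ext w
    cases w <;> by_cases h : j = i <;> simp [X, h]
  have h2 : bracket u (1 : NCSeries σ R) = 0 := by
    have := bracket_mul u 1 1
    simpa using this
  have h3 : ∑ j, u j * lq j (X i : NCSeries σ R) = u i := by
    simp [h1]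
  ext w
  cases w with
  | nil => rw [bracket_nil, h3]
  | cons j w =>
    rw [bracket_cons, h3, h1]
    split_ifs
    · rw [h2]; simp
    · simp

end bracket

end NCSeries

/-! ## The differential operators attached to `F_t` -/

namespace NCSF

section generic

variable {K A At : Type*} [CommRing K] [AddCommGroup A] [Module K A] [AddCommGroup At]
  [Module K At] [Module K⟦X⟧ At] [IsScalarTower K K⟦X⟧ At]

/-- Let `A` stand for the series in `z` over `K` and `At` for those over `K[[t]]`, with the
inclusion `incl : A → At` and the map `tCoeff m : At → A` taking the coefficient of `t^m`.
A `K[[t]]`-linear operator `T` on `At` is written `T = ∑_m t^m T_m`; this is the operator `T_m`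
on `A`. -/
def opCoeff (incl : A →ₗ[K] At) (tCoeff : ℕ → At →ₗ[K] A) (T : At →ₗ[K⟦X⟧] At) (m : ℕ) :
    Module.End K A :=
  tCoeff m ∘ₗ T.restrictScalars K ∘ₗ incl

end generic

/-! ### Noncommutative variables -/

namespace NonComm

variable {K : Type*} [CommRing K] {n : ℕ}

/-- The inclusion of `K⟨⟨z⟩⟩` in `K[[t]]⟨⟨z⟩⟩`. -/
def incl : NCSeries (Fin n) K →ₗ[K] NCSeries (Fin n) K⟦X⟧ where
  toFun u := fun w => PowerSeries.C (u w)
  map_add' u v := by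
    ext1 w
    exact map_add _ _ _
  map_smul' r u := by
    ext1 w
    change PowerSeries.C (r * u w) = r • PowerSeries.C (u w)
    simp [PowerSeries.smul_eq_C_mul]

/-- The coefficient of `t^m` of an element of `K[[t]]⟨⟨z⟩⟩`. -/
def tCoeff (m : ℕ) : NCSeries (Fin n) K⟦X⟧ →ₗ[K] NCSeries (Fin n) K where
  toFun u := fun w => PowerSeries.coeff m (u w)
  map_add' u v := by
    ext1 w
    exact map_add _ _ _
  map_smul' r u := by
    ext1 w
    change PowerSeries.coeff m (r • u w) = r * PowerSeries.coeff m (u w)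
    simp

/-- The derivative `∂/∂t` on `K[[t]]⟨⟨z⟩⟩`. -/
def tDeriv (u : NCSeries (Fin n) K⟦X⟧) : NCSeries (Fin n) K⟦X⟧ :=
  fun w => PowerSeries.derivative K (u w)

/-- An automorphism of `K[[t]]⟨⟨z⟩⟩` over `K[[t]]`; `F_t(z)` is the tuple of the `F z_i`, and
`F u = u(F_t)`, `F.symm u = u(G_t)` with `G_t = F_t⁻¹`. -/
abbrev Aut (n : ℕ) (K : Type*) [CommRing K] :=
  NCSeries (Fin n) K⟦X⟧ ≃ₐ[K⟦X⟧] NCSeries (Fin n) K⟦X⟧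

variable (F : Aut n K)

/-- `λ_m`, from `f(t) = ∑ t^m λ_m` and `f(-t) u = u(F_t)`. -/
def lam (m : ℕ) : Module.End K (NCSeries (Fin n) K) :=
  (-1 : K) ^ m • opCoeff incl tCoeff F.toLinearMap m

/-- `s_m`, from `g(t) = ∑ t^m s_m` and `g(t) u = u(G_t)`. -/
def s (m : ℕ) : Module.End K (NCSeries (Fin n) K) :=
  opCoeff incl tCoeff F.symm.toLinearMap m

/-- `d(t)`, from `d(0) = 0` and `e^{d(t)} = g(t)`. -/
def dSeries [Algebra ℚ K] : (Module.End K (NCSeries (Fin n) K))⟦X⟧ :=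
  logSeries K (PowerSeries.mk (s F))

/-- `φ_m`, from `d(t) = ∑_{m ≥ 1} (t^m / m) φ_m`. -/
def phi [Algebra ℚ K] (m : ℕ) : Module.End K (NCSeries (Fin n) K) :=
  m • PowerSeries.coeff m (dSeries F)

/-- `m(t) = [(∂H_t/∂t)(G_t) ∂/∂z]`, where `H_t(z) = z - F_t(z)`. -/
def mOp : NCSeries (Fin n) K⟦X⟧ →ₗ[K⟦X⟧] NCSeries (Fin n) K⟦X⟧ :=
  NCSeries.bracket fun i => F.symm (tDeriv (NCSeries.X i - F (NCSeries.X i)))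

/-- `ξ_m` (`m ≥ 1`), from `m(t) = ∑_{m ≥ 1} t^{m-1} ξ_m`. -/
def xi (m : ℕ) : Module.End K (NCSeries (Fin n) K) :=
  opCoeff incl tCoeff (mOp F) (m - 1)

/-- `C_1 = H` and `C_m = [C_{m-1} ∂/∂z] H` for `m ≥ 2` (index `0` is unused). -/
def Cvec (H : Fin n → NCSeries (Fin n) K) : ℕ → Fin n → NCSeries (Fin n) K
  | 0 => 0
  | 1 => H
  | m + 2 => fun i => NCSeries.bracket (Cvec H (m + 1)) (H i)

end NonComm

/-! ### Commutative variables -/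

namespace Comm

variable {K : Type*} [CommRing K] {n : ℕ}

/-- The inclusion of `K[[z]]` in `K[[t]][[z]]`. -/
def incl : MvPowerSeries (Fin n) K →ₗ[K] MvPowerSeries (Fin n) K⟦X⟧ where
  toFun u := fun w => PowerSeries.C (MvPowerSeries.coeff w u)
  map_add' u v := by
    refine MvPowerSeries.ext fun w => ?_
    simp only [map_add]
    rfl
  map_smul' r u := by
    refine MvPowerSeries.ext fun w => ?_
    change PowerSeries.C (r * MvPowerSeries.coeff w u) =
      r • PowerSeries.C (MvPowerSeries.coeff w u)
    simp [PowerSeries.smul_eq_C_mul]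

/-- The coefficient of `t^m` of an element of `K[[t]][[z]]`. -/
def tCoeff (m : ℕ) : MvPowerSeries (Fin n) K⟦X⟧ →ₗ[K] MvPowerSeries (Fin n) K where
  toFun u := fun w => PowerSeries.coeff m (MvPowerSeries.coeff w u)
  map_add' u v := by
    refine MvPowerSeries.ext fun w => ?_
    simp only [map_add]
    rfl
  map_smul' r u := by
    refine MvPowerSeries.ext fun w => ?_
    change PowerSeries.coeff m (r • MvPowerSeries.coeff w u) =
      r * PowerSeries.coeff m (MvPowerSeries.coeff w u)
    simp

/-- The derivative `∂/∂t` on `K[[t]][[z]]`. -/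
def tDeriv (u : MvPowerSeries (Fin n) K⟦X⟧) : MvPowerSeries (Fin n) K⟦X⟧ :=
  fun w => PowerSeries.derivative K (MvPowerSeries.coeff w u)

/-- The derivation `[u ∂/∂z] = ∑_i u_i ∂/∂z_i`. -/
def bracket {R : Type*} [CommRing R] (u : Fin n → MvPowerSeries (Fin n) R) :
    MvPowerSeries (Fin n) R →ₗ[R] MvPowerSeries (Fin n) R :=
  (∑ i, u i • MvPowerSeries.pderiv R i : Derivation R _ (MvPowerSeries (Fin n) R)).toLinearMap

/-- An automorphism of `K[[t]][[z]]` over `K[[t]]`; `F_t(z)` is the tuple of the `F z_i`, and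
`F u = u(F_t)`, `F.symm u = u(G_t)` with `G_t = F_t⁻¹`. -/
abbrev Aut (n : ℕ) (K : Type*) [CommRing K] :=
  MvPowerSeries (Fin n) K⟦X⟧ ≃ₐ[K⟦X⟧] MvPowerSeries (Fin n) K⟦X⟧

variable (F : Aut n K)

/-- `λ_m`, from `f(t) = ∑ t^m λ_m` and `f(-t) u = u(F_t)`. -/
def lam (m : ℕ) : Module.End K (MvPowerSeries (Fin n) K) :=
  (-1 : K) ^ m • opCoeff incl tCoeff F.toLinearMap m

/-- `s_m`, from `g(t) = ∑ t^m s_m` and `g(t) u = u(G_t)`. -/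
def s (m : ℕ) : Module.End K (MvPowerSeries (Fin n) K) :=
  opCoeff incl tCoeff F.symm.toLinearMap m

/-- `d(t)`, from `d(0) = 0` and `e^{d(t)} = g(t)`. -/
def dSeries [Algebra ℚ K] : (Module.End K (MvPowerSeries (Fin n) K))⟦X⟧ :=
  logSeries K (PowerSeries.mk (s F))

/-- `φ_m`, from `d(t) = ∑_{m ≥ 1} (t^m / m) φ_m`. -/
def phi [Algebra ℚ K] (m : ℕ) : Module.End K (MvPowerSeries (Fin n) K) :=
  m • PowerSeries.coeff m (dSeries F)

/-- `m(t) = [(∂H_t/∂t)(G_t) ∂/∂z]`, where `H_t(z) = z - F_t(z)`. -/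
def mOp : MvPowerSeries (Fin n) K⟦X⟧ →ₗ[K⟦X⟧] MvPowerSeries (Fin n) K⟦X⟧ :=
  bracket fun i => F.symm (tDeriv (MvPowerSeries.X i - F (MvPowerSeries.X i)))

/-- `ξ_m` (`m ≥ 1`), from `m(t) = ∑_{m ≥ 1} t^{m-1} ξ_m`. -/
def xi (m : ℕ) : Module.End K (MvPowerSeries (Fin n) K) :=
  opCoeff incl tCoeff (mOp F) (m - 1)

/-- `C_1 = H` and `C_m = [C_{m-1} ∂/∂z] H` for `m ≥ 2` (index `0` is unused). -/
def Cvec (H : Fin n → MvPowerSeries (Fin n) K) : ℕ → Fin n → MvPowerSeries (Fin n) K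
  | 0 => 0
  | 1 => H
  | m + 2 => fun i => bracket (Cvec H (m + 1)) (H i)

/-- The Jacobian matrix `JH = (∂H_i/∂z_j)`. -/
def jacobian (H : Fin n → MvPowerSeries (Fin n) K) :
    Matrix (Fin n) (Fin n) (MvPowerSeries (Fin n) K) :=
  Matrix.of fun i j => MvPowerSeries.pderiv K j (H i)

end Comm

end NCSF

end

/-! Everything comes from one derivation, `T = F ∂/∂t F⁻¹ - ∂/∂t`. The terms in `∂c/∂t` cancel, so
`T` is linear over `K[[t]]`, and it is therefore determined by its values at the variables: `T =
[T(z) ∂/∂z]`. From `F(z) = z - tH` one gets `T(z) = H + t T(H)`. Comparing coefficients of `t` gives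
the recursion that defines the `C_m`, so `T(z) = ∑ t^m C_{m+1}` (`twist_var`, `op_twist_var`).

On series that do not involve `t`, the same operator is a logarithmic derivative: writing `F⁻¹` as
`g(t)` and `F` as `f(-t)`, the coefficients of `T` are those of `g⁻¹ g'` and also of `-f(-t)'
f(-t)⁻¹` (`op_twist`, `op_twist'`). Expanding the inverse series as a signed sum over compositions
leaves a single differentiated factor. It is the last part in the first expression and the first
part in the second, which gives the weights `lp` and `fp` and hence the formulas in `s` and `λ`.

The other two formulas follow by substituting expansions of `s_m` into the formula in `s`. The
expansion in `φ` is the exponential series; the one in `ξ` solves `g' = m(t) g`, which holds because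
`m(t)` is minus the twist of `F⁻¹` (`bracketT_eq_neg_twist`). Substitution turns a sum over
compositions into a sum over pairs `I ⪰ J` (`sum_cpow_substitute`).

Commutative and noncommutative variables are treated together through `SeriesPair`. For each kind it
remains to see that derivations and endomorphisms are determined by the variables (the two
`eq_zero_of_map_X_mul`). -/

noncomputable section

namespace NCSF

open Finset.HasAntidiagonal (antidiagonal mem_antidiagonal)

/-! ## Sums over compositions -/

section CompositionSums

/-- The compositions of `m`, as lists of positive integers. -/
def compositionLists (m : ℕ) : Finset (List ℕ) :=
  Finset.univ.image (Composition.blocks (n := m))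

theorem mem_compositionLists {m : ℕ} {l : List ℕ} :
    l ∈ compositionLists m ↔ l.sum = m ∧ ∀ x ∈ l, 0 < x := by
  simp only [compositionLists, Finset.mem_image, Finset.mem_univ, true_and]
  constructor
  · rintro ⟨I, rfl⟩
    exact ⟨I.blocks_sum, fun x hx => I.blocks_pos hx⟩
  · rintro ⟨hs, hp⟩
    exact ⟨⟨l, fun {x} hx => hp x hx, hs⟩, rfl⟩

variable {M : Type*} [AddCommMonoid M]

theorem sum_compositionLists (m : ℕ) (h : List ℕ → M) :
    ∑ l ∈ compositionLists m, h l = ∑ I : Composition m, h I.blocks :=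
  Finset.sum_image fun _ _ _ _ h => Composition.ext h

theorem sum_composition_zero (h : List ℕ → M) : ∑ I : Composition 0, h I.blocks = h [] := by
  have : compositionLists 0 = {[]} := by
    ext l
    rw [mem_compositionLists, Finset.mem_singleton]
    constructor
    · rintro ⟨hs, hp⟩
      cases l with
      | nil => rfl
      | cons a l =>
        have := hp a (by simp)
        simp at hs
        omega
    · rintro rfl
      simp
  rw [← sum_compositionLists, this, Finset.sum_singleton]

/-- Splitting off the first part. -/
theorem sum_composition_succ (m : ℕ) (h : List ℕ → M) :
    ∑ I : Composition (m + 1), h I.blocks =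
      ∑ p ∈ antidiagonal m, ∑ I : Composition p.2, h ((p.1 + 1) :: I.blocks) := by
  have hs (p : ℕ × ℕ) := sum_compositionLists p.2 fun l => h ((p.1 + 1) :: l)
  simp only [← hs]
  rw [← sum_compositionLists, Finset.sum_sigma']
  -- Parts are positive, so the first part is stored minus one; this makes the index run over the
  -- whole antidiagonal of `m`.
  refine Finset.sum_nbij' (fun l => ⟨(l.headD 0 - 1, l.tail.sum), l.tail⟩)
    (fun q => (q.1.1 + 1) :: q.2) ?_ ?_ ?_ ?_ ?_
  · intro l hl
    rw [mem_compositionLists] at hl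
    cases l with
    | nil => simp at hl
    | cons a l =>
      have := hl.2 a (by simp)
      have h1 := hl.1
      simp only [List.sum_cons] at h1
      simp only [Finset.mem_sigma, mem_antidiagonal, mem_compositionLists, List.tail_cons,
        List.headD_cons, true_and]
      exact ⟨by omega, fun x hx => hl.2 x (by simp [hx])⟩
  · rintro ⟨⟨i, j⟩, l⟩ hq
    simp only [Finset.mem_sigma, mem_antidiagonal, mem_compositionLists] at hq
    simp only [mem_compositionLists, List.sum_cons, List.mem_cons, forall_eq_or_imp]
    exact ⟨by omega, by omega, hq.2.2⟩
  · intro l hl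
    rw [mem_compositionLists] at hl
    cases l with
    | nil => simp at hl
    | cons a l =>
      have := hl.2 a (by simp)
      simp only [List.headD_cons, List.tail_cons, List.cons.injEq, and_true]
      omega
  · rintro ⟨⟨i, j⟩, l⟩ hq
    simp only [Finset.mem_sigma, mem_antidiagonal, mem_compositionLists] at hq
    simp [hq.2.1]
  · intro l hl
    rw [mem_compositionLists] at hl
    cases l with
    | nil => simp at hl
    | cons a l =>
      have := hl.2 a (by simp)
      simp only [List.headD_cons, List.tail_cons]
      rw [Nat.sub_add_cancel this]

theorem sum_composition_reverse (m : ℕ) (h : List ℕ → M) :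
    ∑ I : Composition m, h I.blocks.reverse = ∑ I : Composition m, h I.blocks :=
  (Composition.reverse_bijective (n := m)).sum_comp fun I => h I.blocks

/-- Splitting off the last part. -/
theorem sum_composition_succ' (m : ℕ) (h : List ℕ → M) :
    ∑ I : Composition (m + 1), h I.blocks =
      ∑ p ∈ antidiagonal m, ∑ I : Composition p.1, h (I.blocks ++ [p.2 + 1]) := by
  rw [← sum_composition_reverse, sum_composition_succ m fun l => h l.reverse,
    ← Finset.Nat.sum_antidiagonal_swap]
  refine Finset.sum_congr rfl fun p _ => ?_
  simp only [List.reverse_cons, Prod.fst_swap, Prod.snd_swap]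
  exact sum_composition_reverse p.1 fun l => h (l ++ [p.2 + 1])

end CompositionSums

/-! ## Substitution of sums over compositions -/

section Refinements

/-- The ways to replace each entry of a list of positive integers by a composition of it. -/
def cuttings : List ℕ → Finset (List (List ℕ))
  | [] => {[]}
  | j :: l => (compositionLists j ×ˢ cuttings l).image fun q => q.1 :: q.2

theorem mem_cuttings {l : List ℕ} {L : List (List ℕ)} :
    L ∈ cuttings l ↔ L.map List.sum = l ∧ ∀ x ∈ L.flatten, 0 < x := by
  induction l generalizing L with
  | nil =>
    simp only [cuttings, Finset.mem_singleton, List.map_eq_nil_iff]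
    constructor
    · rintro rfl
      simp
    · exact fun h => h.1
  | cons j l ih =>
    simp only [cuttings, Finset.mem_image, Finset.mem_product, mem_compositionLists, ih,
      Prod.exists]
    constructor
    · rintro ⟨p, P, ⟨⟨h1, h2⟩, h3, h4⟩, rfl⟩
      refine ⟨by simp [h1, h3], fun x hx => ?_⟩
      rw [List.flatten_cons, List.mem_append] at hx
      exact hx.elim (h2 x) (h4 x)
    · rintro ⟨h1, h2⟩
      cases L with
      | nil => simp at h1
      | cons p P =>
        simp only [List.map_cons, List.cons.injEq] at h1
        simp only [List.flatten_cons, List.mem_append] at h2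
        exact ⟨p, P, ⟨⟨h1.1, fun x hx => h2 x (Or.inl hx)⟩, h1.2,
          fun x hx => h2 x (Or.inr hx)⟩, rfl⟩

variable {K E : Type*} [CommRing K] [Ring E] [Algebra K E]

/-- Distributivity: expanding the product means choosing one composition for each entry, which is
exactly a cutting; order is kept because `E` is noncommutative. -/
theorem prod_map_sum_composition {c : List ℕ → K} {v w : ℕ → E} {l : List ℕ}
    (hv : ∀ j ∈ l, v j = ∑ I : Composition j, c I.blocks • cpow w I) :
    (l.map v).prod =
      ∑ L ∈ cuttings l, (L.map c).prod • (L.flatten.map w).prod := by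
  induction l with
  | nil => simp [cuttings]
  | cons j l ih =>
    rw [List.map_cons, List.prod_cons, ih fun i hi => hv i (by simp [hi]), hv j (by simp),
      cuttings, Finset.sum_image fun q _ r _ h =>
        Prod.ext (List.cons.inj h).1 (List.cons.inj h).2, Finset.sum_product]
    simp only [cpow]
    rw [← sum_compositionLists j fun p => c p • (p.map w).prod, Finset.sum_mul_sum]
    refine Finset.sum_congr rfl fun p _ => Finset.sum_congr rfl fun P _ => ?_
    rw [smul_mul_smul_comm, List.map_cons, List.prod_cons, List.flatten_cons, List.map_append,
      List.prod_append]

theorem pieces_spec {m : ℕ} {I J : Composition m} (h : Refines I J) :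
    IsCutting I J (pieces I J) := by
  obtain ⟨L, hL⟩ := h
  rwa [pieces_eq hL]

/-- Flattening a cutting gives a refinement of `J`, and uniqueness of the cutting makes `pieces` the
inverse. -/
theorem sum_cuttings {m : ℕ} (J : Composition m) {M : Type*} [AddCommMonoid M]
    (h : List (List ℕ) → M) :
    open Classical in
    ∑ L ∈ cuttings J.blocks, h L = ∑ I : Composition m with Refines I J, h (pieces I J) := by
  classical
  symm
  refine Finset.sum_bij (fun I _ => pieces I J) ?_ ?_ ?_ fun _ _ => rfl
  · intro I hI
    have hc := pieces_spec (Finset.mem_filter.1 hI).2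
    exact mem_cuttings.2 ⟨hc.2, fun x hx => I.blocks_pos (hc.1 ▸ hx)⟩
  · intro I hI I' hI' hII
    have hc := pieces_spec (Finset.mem_filter.1 hI).2
    have hc' := pieces_spec (Finset.mem_filter.1 hI').2
    exact Composition.ext (by rw [← hc.1, ← hc'.1, hII])
  · intro L hL
    obtain ⟨h1, h2⟩ := mem_cuttings.1 hL
    let I : Composition m := ⟨L.flatten, fun {x} hx => h2 x hx, by
      rw [List.sum_flatten, h1, J.blocks_sum]⟩
    have hI : IsCutting I J L := ⟨rfl, h1⟩
    exact ⟨I, by simpa using ⟨L, hI⟩, pieces_eq hI⟩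

/-- If `v_j = ∑_I c(I) w^I` for all `j ≥ 1`, then `∑_J b(J) v^J` is the sum over all `I` of
`w^I` times `∑_J b(J) ∏_a c(I_a)` over the coarsenings `J` of `I`. -/
theorem sum_cpow_substitute {c : List ℕ → K} {v w : ℕ → E}
    (hv : ∀ j, v j = ∑ I : Composition j, c I.blocks • cpow w I) {m : ℕ}
    (b : Composition m → K) :
    ∑ J : Composition m, b J • cpow v J =
      ∑ I : Composition m, (∑ J ∈ coarsenings I, b J * ((pieces I J).map c).prod) • cpow w I := by
  classical
  simp only [coarsenings, Finset.sum_filter, Finset.sum_smul]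
  rw [Finset.sum_comm]
  refine Finset.sum_congr rfl fun J _ => ?_
  rw [cpow, prod_map_sum_composition fun j _ => hv j, sum_cuttings, Finset.sum_filter,
    Finset.smul_sum]
  refine Finset.sum_congr rfl fun I _ => ?_
  split_ifs with h
  · rw [(pieces_spec h).1, smul_smul, cpow]
  · simp

theorem pieces_reverse {m : ℕ} {I J : Composition m} (h : Refines I J) :
    pieces I.reverse J.reverse = ((pieces I J).map List.reverse).reverse := by
  obtain ⟨h1, h2⟩ := pieces_spec h
  refine pieces_eq ⟨?_, ?_⟩
  · change _ = I.blocks.reverse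
    rw [← h1, List.reverse_flatten]
  · change _ = J.blocks.reverse
    rw [← h2, List.map_reverse, List.map_map]
    congr 2
    ext l
    simp

/-- The differential equation produces `π_u` of each piece reversed; this matches it with `π_u` of
the reversed pair. -/
theorem piU₂_reverse {m : ℕ} {I J : Composition m} (h : Refines I J) :
    piU₂ I.reverse J.reverse = ((pieces I J).map fun l => piU l.reverse).prod := by
  rw [piU₂, pieces_reverse h, List.map_reverse, List.prod_reverse, List.map_map]
  rfl

end Refinements

/-! ## Sequences determined by sums over compositions -/

section Sequences

variable {K E : Type*} [CommRing K] [Ring E] [Algebra K E]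

/-- The coefficients of the inverse of a power series with constant term `1`. -/
theorem eq_sum_cpow_of_convolution {a v : ℕ → E} (hv : v 0 = 1) (ha : a 0 = 1)
    (h : ∀ n, ∑ p ∈ antidiagonal (n + 1), v p.1 * a p.2 = 0) (n : ℕ) :
    a n = ∑ I : Composition n, (-1 : K) ^ I.length • cpow v I := by
  simp only [cpow, ← Composition.blocks_length]
  induction n using Nat.strong_induction_on with
  | _ n ih =>
    cases n with
    | zero =>
      rw [sum_composition_zero fun l => (-1 : K) ^ l.length • (l.map v).prod]
      simpa using ha
    | succ n =>
      rw [sum_composition_succ n fun l => (-1 : K) ^ l.length • (l.map v).prod]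
      have := h n
      -- The term with `v 0 = 1` isolates `a (n + 1)`. Each other term prepends a positive part and
      -- contributes one sign.
      rw [Finset.Nat.sum_antidiagonal_succ, hv, one_mul] at this
      rw [eq_neg_of_add_eq_zero_left this, ← Finset.sum_neg_distrib]
      refine Finset.sum_congr rfl fun p hp => ?_
      rw [mem_antidiagonal] at hp
      rw [ih p.2 (by omega), Finset.mul_sum, ← Finset.sum_neg_distrib]
      refine Finset.sum_congr rfl fun I _ => ?_
      simp [pow_succ]

/-- The coefficients of `v⁻¹ v'`: the differentiated factor becomes the last part and supplies its
weight. The factor `-1` corrects the sign for that additional part. -/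
theorem sum_antidiagonal_mul_eq_lp {a v : ℕ → E}
    (ha : ∀ n, a n = ∑ I : Composition n, (-1 : K) ^ I.length • cpow v I) (n : ℕ) :
    ∑ p ∈ antidiagonal n, a p.1 * ((p.2 + 1) • v (p.2 + 1)) =
      (-1 : K) • ∑ I : Composition (n + 1),
        ((-1 : K) ^ I.length * (lp I.blocks : K)) • cpow v I := by
  simp only [cpow, ← Composition.blocks_length] at ha ⊢
  rw [sum_composition_succ' n fun l =>
      ((-1 : K) ^ l.length * (lp l : K)) • (l.map v).prod, Finset.smul_sum]
  refine Finset.sum_congr rfl fun p _ => ?_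
  rw [ha, Finset.sum_mul, Finset.smul_sum]
  refine Finset.sum_congr rfl fun I _ => ?_
  have : lp (I.blocks ++ [p.2 + 1]) = p.2 + 1 := by simp [lp]
  rw [this, ← Nat.cast_smul_eq_nsmul K, smul_mul_smul_comm, smul_smul]
  simp [pow_succ]

/-- The mirror image, for `v' v⁻¹`: the differentiated factor is now the first part. -/
theorem sum_antidiagonal_mul_eq_fp {a v : ℕ → E}
    (ha : ∀ n, a n = ∑ I : Composition n, (-1 : K) ^ I.length • cpow v I) (n : ℕ) :
    ∑ p ∈ antidiagonal n, ((p.1 + 1) • v (p.1 + 1)) * a p.2 =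
      (-1 : K) • ∑ I : Composition (n + 1),
        ((-1 : K) ^ I.length * (fp I.blocks : K)) • cpow v I := by
  simp only [cpow, ← Composition.blocks_length] at ha ⊢
  rw [sum_composition_succ n fun l =>
      ((-1 : K) ^ l.length * (fp l : K)) • (l.map v).prod, Finset.smul_sum]
  refine Finset.sum_congr rfl fun p _ => ?_
  rw [ha, Finset.mul_sum, Finset.smul_sum]
  refine Finset.sum_congr rfl fun I _ => ?_
  rw [fp, List.headD_cons, ← Nat.cast_smul_eq_nsmul K, smul_mul_smul_comm, smul_smul]
  simp [pow_succ, mul_comm]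

/-- Rescaling the sequence by powers of a scalar. -/
theorem cpow_smul_pow (r : K) (v : ℕ → E) {m : ℕ} (I : Composition m) :
    cpow (fun j => r ^ j • v j) I = r ^ m • cpow v I := by
  have : ∀ l : List ℕ, (l.map fun j => r ^ j • v j).prod = r ^ l.sum • (l.map v).prod := by
    intro l
    induction l with
    | nil => simp
    | cons j l ih =>
      rw [List.map_cons, List.prod_cons, ih, smul_mul_smul_comm, ← pow_add, List.sum_cons,
        List.map_cons, List.prod_cons]
  rw [cpow, this, I.blocks_sum, cpow]

/-- Since `d(0) = 0`, only strictly positive exponents contribute to the `k`-fold product, so they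
form compositions of length `k`. -/
theorem coeff_pow_eq_sum {d : E⟦X⟧} (hd : PowerSeries.coeff 0 d = 0) (k n : ℕ) :
    PowerSeries.coeff n (d ^ k) = ∑ I : Composition n,
      if I.length = k then cpow (fun j => PowerSeries.coeff j d) I else 0 := by
  simp only [cpow, ← Composition.blocks_length]
  set e : ℕ → E := fun j => PowerSeries.coeff j d with he
  induction k generalizing n with
  | zero =>
    cases n with
    | zero =>
      rw [sum_composition_zero fun l => if l.length = 0 then (l.map e).prod else 0]
      simp
    | succ n =>
      rw [sum_composition_succ n fun l => if l.length = 0 then (l.map e).prod else 0]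
      simp [PowerSeries.coeff_one]
  | succ k ih =>
    rw [pow_succ', PowerSeries.coeff_mul]
    cases n with
    | zero =>
      rw [sum_composition_zero fun l => if l.length = k + 1 then (l.map e).prod else 0]
      simp [hd, -PowerSeries.coeff_zero_eq_constantCoeff]
    | succ n =>
      rw [sum_composition_succ n fun l => if l.length = k + 1 then (l.map e).prod else 0,
        Finset.Nat.sum_antidiagonal_succ, hd, zero_mul, zero_add]
      refine Finset.sum_congr rfl fun p _ => ?_
      rw [ih, Finset.mul_sum]
      refine Finset.sum_congr rfl fun I _ => ?_
      simp [he]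

variable [Algebra ℚ K]

theorem algebraMap_inv_smul_nsmul {j : ℕ} (hj : 0 < j) (x : E) :
    algebraMap ℚ K ((j : ℚ)⁻¹) • (j • x) = x := by
  rw [← Nat.cast_smul_eq_nsmul K, smul_smul, ← map_natCast (algebraMap ℚ K) j, ← map_mul,
    inv_mul_cancel₀ (by exact_mod_cast hj.ne'), map_one, one_smul]

/-- The coefficients of `exp (∑_{m ≥ 1} φ_m t^m / m)`. -/
theorem coeff_expSeries_eq_sum {d : E⟦X⟧} (hd : PowerSeries.coeff 0 d = 0) (n : ℕ) :
    PowerSeries.coeff n (expSeries K d) = ∑ I : Composition n,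
      algebraMap ℚ K ((sp I.blocks : ℚ)⁻¹) • cpow (fun j => j • PowerSeries.coeff j d) I := by
  have key : ∀ l : List ℕ, (∀ x ∈ l, 0 < x) → (l.map fun j => PowerSeries.coeff j d).prod =
      algebraMap ℚ K ((l.prod : ℚ)⁻¹) • (l.map fun j => j • PowerSeries.coeff j d).prod := by
    intro l hl
    induction l with
    | nil => simp
    | cons j l ih =>
      rw [List.map_cons, List.map_cons, List.prod_cons, List.prod_cons, List.prod_cons,
        ih fun x hx => hl x (by simp [hx]), Nat.cast_mul, mul_inv, map_mul,
        ← smul_mul_smul_comm, algebraMap_inv_smul_nsmul (hl j (by simp))]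
  rw [expSeries, PowerSeries.coeff_mk]
  simp only [coeff_pow_eq_sum hd, Finset.smul_sum, smul_ite, smul_zero]
  rw [Finset.sum_comm]
  refine Finset.sum_congr rfl fun I _ => ?_
  -- A composition of `n` has at most `n` parts, so the truncation of the exponential at `k ≤ n`
  -- discards none.
  rw [Finset.sum_ite_eq, if_pos (Finset.mem_range.2 (Nat.lt_succ_of_le I.length_le)), cpow,
    key _ fun x hx => I.blocks_pos hx, smul_smul, ← map_mul, sp, cpow, Composition.blocks_length,
    Nat.cast_mul, mul_inv, one_div]

theorem piU_append_singleton (l : List ℕ) (j : ℕ) : piU (l ++ [j]) = piU l * (l.sum + j) := by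
  rw [piU, List.length_append, List.length_singleton, Finset.prod_range_succ, piU]
  congr 1
  · refine Finset.prod_congr rfl fun i hi => ?_
    rw [List.take_append_of_le_length (by simpa using hi)]
  · rw [List.take_of_length_le (by simp)]
    simp

/-- The solution of `v' = x v`, `v(0) = 1`. -/
theorem eq_sum_cpow_of_ode {v x : ℕ → E} (hv : v 0 = 1)
    (h : ∀ n, (n + 1) • v (n + 1) = ∑ p ∈ antidiagonal n, x (p.1 + 1) * v p.2) (n : ℕ) :
    v n = ∑ I : Composition n, algebraMap ℚ K ((piU I.blocks.reverse : ℚ)⁻¹) • cpow x I := by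
  simp only [cpow]
  induction n using Nat.strong_induction_on with
  | _ n ih =>
    cases n with
    | zero =>
      rw [sum_composition_zero fun l =>
        algebraMap ℚ K ((piU l.reverse : ℚ)⁻¹) • (l.map x).prod]
      simpa [piU] using hv
    | succ n =>
      rw [sum_composition_succ n fun l =>
        algebraMap ℚ K ((piU l.reverse : ℚ)⁻¹) • (l.map x).prod,
        ← algebraMap_inv_smul_nsmul (K := K) n.succ_pos (v (n + 1)), Nat.succ_eq_add_one, h,
        Finset.smul_sum]
      refine Finset.sum_congr rfl fun p hp => ?_
      rw [mem_antidiagonal] at hp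
      rw [ih p.2 (by omega), Finset.mul_sum, Finset.smul_sum]
      refine Finset.sum_congr rfl fun I _ => ?_
      -- The new first part is last after reversal, so it adds to `π_u` only the full sum `n + 1`,
      -- the divisor in the recursion for `v (n + 1)`.
      rw [List.reverse_cons, piU_append_singleton, List.sum_reverse, I.blocks_sum,
        show p.2 + (p.1 + 1) = n + 1 by omega, Nat.cast_mul, mul_inv, mul_comm, map_mul, mul_smul,
        mul_smul_comm, List.map_cons, List.prod_cons]

end Sequences

end NCSF

namespace NCSF

open Finset.HasAntidiagonal (antidiagonal mem_antidiagonal)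

/-! ## Automorphisms of algebras of formal power series -/

/-- What is used about the algebras `A` and `At` of formal power series in `z` over `K` and over
`K[[t]]`: the inclusion, the coefficients and the derivative with respect to `t`, the derivations
`[u ∂/∂z]`, and the variables. -/
structure SeriesPair (K : Type*) (n : ℕ) (A At : Type*) [CommRing K] [Ring A] [Algebra K A]
    [Ring At] [Algebra K⟦X⟧ At] [Module K At] [IsScalarTower K K⟦X⟧ At] where
  incl : A →ₗ[K] At
  tCoeff : ℕ → At →ₗ[K] A
  tDeriv : At → At
  bracket : (Fin n → A) → A →ₗ[K] A
  bracketT : (Fin n → At) → At →ₗ[K⟦X⟧] At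
  var : Fin n → A
  varT : Fin n → At
  ext_tCoeff : ∀ {u v : At}, (∀ m, tCoeff m u = tCoeff m v) → u = v
  tCoeff_incl : ∀ m a, tCoeff m (incl a) = if m = 0 then a else 0
  exists_eq_add_smul : ∀ u : At, ∃ v, u = incl (tCoeff 0 u) + (PowerSeries.X : K⟦X⟧) • v
  tCoeff_zero_smul : ∀ u : At, tCoeff 0 ((PowerSeries.X : K⟦X⟧) • u) = 0
  tCoeff_succ_smul : ∀ m (u : At), tCoeff (m + 1) ((PowerSeries.X : K⟦X⟧) • u) = tCoeff m u
  tCoeff_zero_mul : ∀ u v : At, tCoeff 0 (u * v) = tCoeff 0 u * tCoeff 0 v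
  tCoeff_tDeriv : ∀ m u, tCoeff m (tDeriv u) = (m + 1) • tCoeff (m + 1) u
  tDeriv_mul : ∀ u v, tDeriv (u * v) = tDeriv u * v + u * tDeriv v
  tDeriv_smul : ∀ (c : K⟦X⟧) u, tDeriv (c • u) = PowerSeries.derivative K c • u + c • tDeriv u
  incl_one : incl 1 = 1
  incl_mul : ∀ a b, incl (a * b) = incl a * incl b
  incl_var : ∀ i, incl (var i) = varT i
  tCoeff_bracketT_incl : ∀ m u a,
    tCoeff m (bracketT u (incl a)) = bracket (fun i => tCoeff m (u i)) a
  eq_bracketT : ∀ D : At →ₗ[K⟦X⟧] At, (∀ u v, D (u * v) = D u * v + u * D v) →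
    D = bracketT fun i => D (varT i)
  eq_id : ∀ α : A →ₗ[K] A, α 1 = 1 → (∀ a b, α (a * b) = α a * α b) →
    (∀ i, α (var i) = var i) → α = LinearMap.id

theorem toLinearMap_comp_symm {R B : Type*} [CommRing R] [Ring B] [Algebra R B] (F : B ≃ₐ[R] B) :
    F.toLinearMap ∘ₗ F.symm.toLinearMap = LinearMap.id := by
  ext u
  exact F.apply_symm_apply u

/-! ### Operators as power series in `t`, and the twist derivation. -/

namespace SeriesPair

variable {K : Type*} {n : ℕ} {A At : Type*} [CommRing K] [Ring A] [Algebra K A]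
    [Ring At] [Algebra K⟦X⟧ At] [Module K At] [IsScalarTower K K⟦X⟧ At]
    (P : SeriesPair K n A At)

/-- The coefficients of `T = ∑_m t^m T_m`. -/
abbrev op (T : At →ₗ[K⟦X⟧] At) (m : ℕ) : Module.End K A := opCoeff P.incl P.tCoeff T m

theorem tDeriv_add (u v : At) : P.tDeriv (u + v) = P.tDeriv u + P.tDeriv v :=
  P.ext_tCoeff fun m => by simp only [map_add, P.tCoeff_tDeriv, smul_add]

theorem tDeriv_incl (a : A) : P.tDeriv (P.incl a) = 0 :=
  P.ext_tCoeff fun m => by simp [P.tCoeff_tDeriv, P.tCoeff_incl]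

/-- No continuity of `T` is needed: writing `u = u₀ + t v` and using linearity over `K[[t]]` lowers
`m` by one. -/
theorem tCoeff_apply (T : At →ₗ[K⟦X⟧] At) (m : ℕ) (u : At) :
    P.tCoeff m (T u) = ∑ p ∈ antidiagonal m, P.op T p.1 (P.tCoeff p.2 u) := by
  induction m generalizing u with
  | zero =>
    obtain ⟨v, hv⟩ := P.exists_eq_add_smul u
    conv_lhs => rw [hv, map_add, map_smul, map_add, P.tCoeff_zero_smul, add_zero]
    simp [opCoeff]
  | succ m ih =>
    obtain ⟨v, hv⟩ := P.exists_eq_add_smul u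
    have h : ∀ j, P.tCoeff (j + 1) u = P.tCoeff j v := by
      intro j
      rw [hv, map_add, P.tCoeff_succ_smul, P.tCoeff_incl, if_neg j.succ_ne_zero, zero_add]
    conv_lhs => rw [hv, map_add, map_smul, map_add, P.tCoeff_succ_smul, ih]
    rw [Finset.Nat.sum_antidiagonal_succ']
    simp only [h]
    rfl

theorem op_comp (S T : At →ₗ[K⟦X⟧] At) (m : ℕ) :
    P.op (S ∘ₗ T) m = ∑ p ∈ antidiagonal m, P.op S p.1 * P.op T p.2 := by
  ext a
  rw [LinearMap.sum_apply]
  exact P.tCoeff_apply S m (T (P.incl a))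

theorem op_id (m : ℕ) : P.op LinearMap.id m = if m = 0 then 1 else 0 := by
  ext a
  have := P.tCoeff_incl m a
  split_ifs with h <;> simpa [opCoeff, h] using this

/-- Modulo `t`, `F` is an algebra endomorphism fixing the variables, hence the identity. -/
theorem op_zero_eq_one (F : At →ₐ[K⟦X⟧] At)
    (hF : ∀ i, P.tCoeff 0 (F (P.varT i)) = P.var i) : P.op F.toLinearMap 0 = 1 := by
  refine P.eq_id _ ?_ ?_ fun i => ?_
  · change P.tCoeff 0 (F (P.incl 1)) = 1
    rw [P.incl_one, map_one, ← P.incl_one, P.tCoeff_incl, if_pos rfl]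
  · intro a b
    change P.tCoeff 0 (F (P.incl (a * b))) = P.tCoeff 0 (F (P.incl a)) * P.tCoeff 0 (F (P.incl b))
    rw [P.incl_mul, map_mul, P.tCoeff_zero_mul]
  · change P.tCoeff 0 (F (P.incl (P.var i))) = P.var i
    rw [P.incl_var, hF]

/-- The commutator of `∂/∂t` with an automorphism, as the `K[[t]]`-linear derivation
`F ∂/∂t F⁻¹ - ∂/∂t`. -/
def twist (F : At ≃ₐ[K⟦X⟧] At) : At →ₗ[K⟦X⟧] At where
  toFun u := F (P.tDeriv (F.symm u)) - P.tDeriv u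
  map_add' u v := by
    simp only [map_add, P.tDeriv_add]
    abel
  -- Both `F ∂/∂t F⁻¹` and `∂/∂t` produce the term `c' u`, which cancels in the difference.
  map_smul' c u := by
    simp only [map_smul, map_add, P.tDeriv_smul, AlgEquiv.apply_symm_apply, RingHom.id_apply,
      smul_sub]
    abel

theorem twist_apply (F : At ≃ₐ[K⟦X⟧] At) (u : At) :
    P.twist F u = F (P.tDeriv (F.symm u)) - P.tDeriv u := rfl

theorem twist_mul (F : At ≃ₐ[K⟦X⟧] At) (u v : At) :
    P.twist F (u * v) = P.twist F u * v + u * P.twist F v := by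
  simp only [twist_apply, map_mul, map_add, P.tDeriv_mul, AlgEquiv.apply_symm_apply, sub_mul,
    mul_sub]
  abel

theorem twist_incl (F : At ≃ₐ[K⟦X⟧] At) (a : A) :
    P.twist F (P.incl a) = F (P.tDeriv (F.symm (P.incl a))) := by
  rw [twist_apply, P.tDeriv_incl, sub_zero]

/-- On series without `t` the term `∂/∂t` vanishes, leaving `F ∂/∂t F⁻¹`, that is, `g⁻¹ g'`. -/
theorem op_twist (F : At ≃ₐ[K⟦X⟧] At) (m : ℕ) :
    P.op (P.twist F) m = ∑ p ∈ antidiagonal m,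
      P.op F.toLinearMap p.1 * ((p.2 + 1) • P.op F.symm.toLinearMap (p.2 + 1)) := by
  ext a
  change P.tCoeff m (P.twist F (P.incl a)) = _
  rw [twist_incl, LinearMap.sum_apply]
  refine (P.tCoeff_apply F.toLinearMap m _).trans (Finset.sum_congr rfl fun p _ => ?_)
  rw [P.tCoeff_tDeriv]
  rfl

/-- Here `T F = F ∂/∂t - ∂/∂t F`, and the first term kills series without `t`. -/
theorem op_twist_comp (F : At ≃ₐ[K⟦X⟧] At) (m : ℕ) :
    P.op (P.twist F ∘ₗ F.toLinearMap) m = -((m + 1) • P.op F.toLinearMap (m + 1)) := by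
  ext a
  change P.tCoeff m (P.twist F (F (P.incl a))) = _
  rw [twist_apply, F.symm_apply_apply, P.tDeriv_incl, map_zero, zero_sub, map_neg,
    P.tCoeff_tDeriv]
  rfl

theorem op_twist' (F : At ≃ₐ[K⟦X⟧] At) (m : ℕ) :
    P.op (P.twist F) m = -∑ p ∈ antidiagonal m,
      ((p.1 + 1) • P.op F.toLinearMap (p.1 + 1)) * P.op F.symm.toLinearMap p.2 := by
  have h : P.twist F = (P.twist F ∘ₗ F.toLinearMap) ∘ₗ F.symm.toLinearMap := by
    rw [LinearMap.comp_assoc, toLinearMap_comp_symm, LinearMap.comp_id]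
  rw [h, op_comp, ← Finset.sum_neg_distrib]
  refine Finset.sum_congr rfl fun p _ => ?_
  rw [op_twist_comp]
  exact neg_mul (α := Module.End K A) _ _

theorem sum_op_mul_op_symm (F : At ≃ₐ[K⟦X⟧] At) (m : ℕ) :
    ∑ p ∈ antidiagonal (m + 1), P.op F.toLinearMap p.1 * P.op F.symm.toLinearMap p.2 = 0 := by
  rw [← op_comp, toLinearMap_comp_symm, op_id, if_neg m.succ_ne_zero]

/-! ### Automorphisms of the form `z - tH(z)`. -/

variable {P} {F : At ≃ₐ[K⟦X⟧] At} {H : Fin n → A}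

section

variable (hF : ∀ i, F (P.varT i) = P.varT i - (PowerSeries.X : K⟦X⟧) • P.incl (H i))
include hF

theorem op_zero : P.op F.toLinearMap 0 = 1 :=
  P.op_zero_eq_one F.toAlgHom fun i => by
    change P.tCoeff 0 (F (P.varT i)) = _
    rw [hF, map_sub, P.tCoeff_zero_smul, sub_zero, ← P.incl_var, P.tCoeff_incl, if_pos rfl]

theorem op_symm_zero : P.op F.symm.toLinearMap 0 = 1 := by
  have := P.op_comp F.toLinearMap F.symm.toLinearMap 0
  rw [toLinearMap_comp_symm, op_id, if_pos rfl] at this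
  simpa [op_zero hF] using this.symm

/-- The derivation `F ∂/∂t F⁻¹ - ∂/∂t` maps `z_i` to `∑_m t^m C_{m+1}`. -/
theorem twist_var (i : Fin n) : P.twist F (P.varT i) =
    P.incl (H i) + (PowerSeries.X : K⟦X⟧) • P.twist F (P.incl (H i)) := by
  -- Applying `F⁻¹` to `F(z) = z - tH` gives `G_t = z + t H(G_t)`; differentiating in `t` and
  -- applying `F` then yields the claim.
  have h : F.symm (P.varT i) =
      P.varT i + (PowerSeries.X : K⟦X⟧) • F.symm (P.incl (H i)) := by
    have := congrArg F.symm (hF i)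
    rw [F.symm_apply_apply, map_sub, map_smul] at this
    exact (sub_eq_iff_eq_add.1 this.symm)
  rw [← P.incl_var, twist_incl, twist_incl, P.incl_var, h, P.tDeriv_add, ← P.incl_var,
    P.tDeriv_incl, zero_add, P.tDeriv_smul, PowerSeries.derivative_X, one_smul, map_add,
    F.apply_symm_apply, map_smul]

/-- In `T(z) = H + t T(H)`, the derivation `T` is `[T(z) ∂/∂z]`, so each coefficient of `T(z)` is
the bracket of the preceding one applied to `H`. -/
theorem op_twist_var {C : ℕ → Fin n → A} (h0 : C 0 = H)
    (h1 : ∀ m i, C (m + 1) i = P.bracket (C m) (H i)) (m : ℕ) (i : Fin n) :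
    P.op (P.twist F) m (P.var i) = C m i := by
  have h : ∀ m i, P.op (P.twist F) m (P.var i) = P.tCoeff m (P.twist F (P.varT i)) := by
    intro m i
    rw [← P.incl_var]
    rfl
  rw [h]
  induction m generalizing i with
  | zero => rw [twist_var hF, map_add, P.tCoeff_zero_smul, P.tCoeff_incl, if_pos rfl, add_zero, h0]
  | succ m ih =>
    rw [twist_var hF, map_add, P.tCoeff_succ_smul, P.tCoeff_incl, if_neg m.succ_ne_zero, zero_add,
      P.eq_bracketT _ (P.twist_mul F), P.tCoeff_bracketT_incl, h1]
    congr 2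
    funext j
    exact ih j

/-- Both sides are derivations, so it suffices to compare them at the variables, where each equals
`F⁻¹(H_i)`. -/
theorem bracketT_eq_neg_twist :
    P.bracketT (fun i => F.symm (P.tDeriv (P.varT i - F (P.varT i)))) = -P.twist F.symm := by
  rw [P.eq_bracketT (-P.twist F.symm) fun u v => by
    simp only [LinearMap.neg_apply, P.twist_mul, neg_mul, mul_neg]
    abel]
  congr 1
  funext i
  rw [LinearMap.neg_apply, hF, sub_sub_cancel, ← P.incl_var, twist_incl, AlgEquiv.symm_symm,
    P.incl_var, hF, sub_eq_add_neg, P.tDeriv_add, ← P.incl_var, P.tDeriv_incl, zero_add,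
    ← smul_neg, ← map_neg P.incl, P.tDeriv_smul, P.tDeriv_smul, P.tDeriv_incl, P.tDeriv_incl,
    PowerSeries.derivative_X]
  simp

/-- The equation `g' = m(t) g`, read off from `op_twist_comp` for `F⁻¹`. -/
theorem succ_smul_op_symm (m : ℕ) :
    (m + 1) • P.op F.symm.toLinearMap (m + 1) = ∑ p ∈ antidiagonal m,
      P.op (P.bracketT fun i => F.symm (P.tDeriv (P.varT i - F (P.varT i)))) p.1 *
        P.op F.symm.toLinearMap p.2 := by
  have h := P.op_twist_comp F.symm m
  rw [← neg_eq_iff_eq_neg] at h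
  rw [← op_comp, bracketT_eq_neg_twist hF, ← h, LinearMap.neg_comp]
  ext a
  simp [opCoeff]

end

/-! ### The four formulas as identities between operators. -/

variable {E : Type*} [Ring E] [Algebra K E]

/-- The four expressions of `C_m` for a sequence of operators. -/
structure Formulas [Algebra ℚ K] (lam s phi xi : ℕ → E) (m : ℕ) (c : E) : Prop where
  lam : c = (-1 : K) ^ m • ∑ I : Composition m,
    ((-1 : K) ^ I.length * (fp I.blocks : K)) • cpow lam I
  s : c = (-1 : K) • ∑ I : Composition m,
    ((-1 : K) ^ I.length * (lp I.blocks : K)) • cpow s I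
  phi : c = (-1 : K) • ∑ I : Composition m,
    algebraMap ℚ K (∑ J ∈ coarsenings I,
      (-1 : ℚ) ^ J.length * ((lp J.blocks : ℚ) / (sp₂ I J : ℚ))) • cpow phi I
  xi : c = ∑ I : Composition m,
    algebraMap ℚ K (∑ J ∈ coarsenings I,
      (-1 : ℚ) ^ (J.length - 1) *
        ((lp J.blocks : ℚ) / (piU₂ I.reverse J.reverse : ℚ))) • cpow xi I

variable [Algebra ℚ K]

theorem prod_map_inv (f : List ℕ → ℕ) (L : List (List ℕ)) :
    (L.map fun l => algebraMap ℚ K ((f l : ℚ)⁻¹)).prod =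
      algebraMap ℚ K (((L.map f).prod : ℚ)⁻¹) := by
  induction L with
  | nil => simp
  | cons l L ih => simp [ih, mul_comm]

theorem formulas_op_twist
    (hF : ∀ i, F (P.varT i) = P.varT i - (PowerSeries.X : K⟦X⟧) • P.incl (H i)) (m : ℕ) :
    Formulas (K := K) (fun j => (-1 : K) ^ j • P.op F.toLinearMap j)
      (P.op F.symm.toLinearMap)
      (fun j => j • PowerSeries.coeff j
        (logSeries K (PowerSeries.mk (P.op F.symm.toLinearMap))))
      (fun j => P.op (P.bracketT fun i => F.symm (P.tDeriv (P.varT i - F (P.varT i)))) (j - 1))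
      (m + 1) (P.op (P.twist F) m) := by
  have h0 := op_zero hF
  have h0' := op_symm_zero hF
  have hs : P.op (P.twist F) m = (-1 : K) • ∑ I : Composition (m + 1),
      ((-1 : K) ^ I.length * (lp I.blocks : K)) • cpow (P.op F.symm.toLinearMap) I := by
    rw [op_twist, sum_antidiagonal_mul_eq_lp (K := K)
      (eq_sum_cpow_of_convolution h0' h0 (P.sum_op_mul_op_symm F.symm))]
  refine ⟨?_, hs, ?_, ?_⟩
  · rw [op_twist', sum_antidiagonal_mul_eq_fp (K := K)
      (eq_sum_cpow_of_convolution h0 h0' (P.sum_op_mul_op_symm F))]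
    -- The minus sign of `op_twist'` cancels the one from the weighted sum. Rescaling `F_j = (-1)^j
    -- λ_j` contributes `(-1)^(m+1)` to every composition of `m + 1`.
    rw [Finset.smul_sum, Finset.smul_sum, ← Finset.sum_neg_distrib]
    refine Finset.sum_congr rfl fun I _ => ?_
    rw [show cpow (fun j => (-1 : K) ^ j • P.op F.toLinearMap j) I = _ from
      cpow_smul_pow _ _ I, smul_smul, smul_smul, smul_smul, mul_right_comm, ← mul_pow]
    simp
  · have hg : PowerSeries.coeff 0 (PowerSeries.mk (P.op F.symm.toLinearMap)) = 1 := by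
      rw [PowerSeries.coeff_mk, h0']
    obtain ⟨hd, he⟩ := logSeries_spec (K := K) hg
    have hv := coeff_expSeries_eq_sum (K := K) hd
    simp only [he, PowerSeries.coeff_mk] at hv
    rw [hs, sum_cpow_substitute (c := fun l => algebraMap ℚ K ((sp l : ℚ)⁻¹)) hv]
    congr 1
    refine Finset.sum_congr rfl fun I _ => ?_
    rw [map_sum]
    congr 1
    refine Finset.sum_congr rfl fun J _ => ?_
    rw [prod_map_inv, ← sp₂, div_eq_mul_inv, ← mul_assoc, map_mul, map_mul, map_pow, map_neg,
      map_one, map_natCast]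
  · have hv := eq_sum_cpow_of_ode (K := K) (x := fun j =>
      P.op (P.bracketT fun i => F.symm (P.tDeriv (P.varT i - F (P.varT i)))) (j - 1)) h0'
      (succ_smul_op_symm hF)
    rw [hs, sum_cpow_substitute (c := fun l => algebraMap ℚ K ((piU l.reverse : ℚ)⁻¹)) hv,
      Finset.smul_sum]
    refine Finset.sum_congr rfl fun I _ => ?_
    rw [map_sum, smul_smul, Finset.mul_sum]
    congr 1
    refine Finset.sum_congr rfl fun J hJ => ?_
    -- A composition of `m + 1` is nonempty, so the truncated exponent `J.length - 1` is genuine and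
    -- absorbs the outer sign.
    obtain ⟨k, hk⟩ : ∃ k, J.length = k + 1 :=
      ⟨J.length - 1, by have := J.length_pos_iff.2 m.succ_pos; omega⟩
    rw [prod_map_inv fun l => piU l.reverse, piU₂_reverse (by simpa [coarsenings] using hJ),
      div_eq_mul_inv, ← mul_assoc ((-1 : ℚ) ^ _), map_mul, map_mul, map_pow, map_neg, map_one,
      map_natCast, hk, Nat.add_sub_cancel, pow_succ]
    ring

theorem Formulas.apply_var {lam s phi xi : ℕ → Module.End K A} {m : ℕ} {c : Module.End K A}
    (h : Formulas (K := K) lam s phi xi m c) {a b : A} (hc : c a = b) :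
    b = (-1 : K) ^ m • ∑ I : Composition m,
      ((-1 : K) ^ I.length * (fp I.blocks : K)) • cpow lam I a ∧
    b = (-1 : K) • ∑ I : Composition m,
      ((-1 : K) ^ I.length * (lp I.blocks : K)) • cpow s I a ∧
    b = (-1 : K) • ∑ I : Composition m,
      algebraMap ℚ K (∑ J ∈ coarsenings I,
        (-1 : ℚ) ^ J.length * ((lp J.blocks : ℚ) / (sp₂ I J : ℚ))) • cpow phi I a ∧
    b = ∑ I : Composition m,
      algebraMap ℚ K (∑ J ∈ coarsenings I,
        (-1 : ℚ) ^ (J.length - 1) *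
          ((lp J.blocks : ℚ) / (piU₂ I.reverse J.reverse : ℚ))) • cpow xi I a := by
  subst hc
  refine ⟨?_, ?_, ?_, ?_⟩
  · simpa only [LinearMap.smul_apply, LinearMap.sum_apply] using LinearMap.congr_fun h.lam a
  · simpa only [LinearMap.smul_apply, LinearMap.sum_apply] using LinearMap.congr_fun h.s a
  · simpa only [LinearMap.smul_apply, LinearMap.sum_apply] using LinearMap.congr_fun h.phi a
  · simpa only [LinearMap.smul_apply, LinearMap.sum_apply] using LinearMap.congr_fun h.xi a

end SeriesPair

end NCSF

/-! ## Linear maps commuting with multiplication by the variables -/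

namespace NCSeries

variable {σ R : Type*} [CommRing R]

theorem lq_X [DecidableEq σ] (i j : σ) :
    lq j (X i : NCSeries σ R) = if j = i then 1 else 0 := by
  ext w
  cases w <;> by_cases h : j = i <;> simp [X, h]

theorem X_mul_nil [DecidableEq σ] (i : σ) (f : NCSeries σ R) : ((X i : NCSeries σ R) * f) [] = 0 := by
  simp [mul_nil, X]

theorem X_mul_cons [DecidableEq σ] (i j : σ) (f : NCSeries σ R) (w : List σ) :
    ((X i : NCSeries σ R) * f) (j :: w) = if j = i then f w else 0 := by
  rw [mul_cons, lq_X]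
  split_ifs <;> simp [X]

theorem eq_smul_one_add_sum [Fintype σ] [DecidableEq σ] (f : NCSeries σ R) :
    f = f [] • 1 + ∑ i, X i * lq i f := by
  ext w
  cases w <;> simp [sum_apply, X_mul_nil, X_mul_cons]

/-- With finitely many variables a series is its constant term plus a finite sum of the `z_i` times
its left quotients. The coefficient of `j :: w` in `T f` is then that of `w` in `T (lq j f)`, and
linearity suffices without continuity. -/
theorem eq_zero_of_map_X_mul [Fintype σ] [DecidableEq σ] (T : NCSeries σ R →ₗ[R] NCSeries σ R)
    (h1 : T 1 = 0) (hX : ∀ i f, T (X i * f) = X i * T f) : T = 0 := by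
  ext f w
  induction w generalizing f with
  | nil =>
    rw [eq_smul_one_add_sum f, map_add, map_smul, h1, map_sum]
    simp [hX, sum_apply, X_mul_nil]
  | cons j w ih =>
    rw [eq_smul_one_add_sum f, map_add, map_smul, h1, map_sum]
    simp only [hX, add_apply, sum_apply, X_mul_cons, ih]
    simp

end NCSeries

namespace MvPowerSeries

variable {σ R : Type*} [CommRing R]

theorem exists_eq_sum_X_mul (s : Finset σ) (f : MvPowerSeries σ R)
    (hf : ∀ d, (∀ i ∈ s, d i = 0) → coeff d f = 0) :
    ∃ g : σ → MvPowerSeries σ R, f = ∑ i ∈ s, X i * g i := by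
  classical
  induction s using Finset.induction_on generalizing f with
  | empty => exact ⟨0, ext fun d => by simpa using hf d (by simp)⟩
  | insert i s hi ih =>
    -- `f'` collects the monomials free of `z_i`; the rest is divisible by `z_i`, and `f'` is left
    -- to the remaining variables.
    let f' : MvPowerSeries σ R := fun d => if d i = 0 then coeff d f else 0
    have hf' : ∀ d, coeff d f' = if d i = 0 then coeff d f else 0 := fun _ => rfl
    obtain ⟨g, hg⟩ := ih f' fun d hd => by
      rw [hf']
      split_ifs with h
      · exact hf d fun j hj => (Finset.mem_insert.1 hj).elim (fun e => e ▸ h) (hd j)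
      · rfl
    obtain ⟨k, hk⟩ : X i ∣ f - f' := X_dvd_iff.2 fun d hd => by
      rw [map_sub, hf', if_pos hd, sub_self]
    refine ⟨Function.update g i k, ?_⟩
    rw [Finset.sum_insert hi, Function.update_self, ← hk, Finset.sum_congr rfl fun j hj => by
      rw [Function.update_of_ne (ne_of_mem_of_not_mem hj hi)], ← hg, sub_add_cancel]

/-- Up to its constant term `f` is a finite sum `∑ z_i g_i`, so a coefficient of `T f` is a sum of
coefficients of the `T g_i` in degree one less; induction on the degree handles all series at once.
-/
theorem eq_zero_of_map_X_mul [Fintype σ] (T : MvPowerSeries σ R →ₗ[R] MvPowerSeries σ R)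
    (h1 : T 1 = 0) (hX : ∀ i f, T (X i * f) = X i * T f) : T = 0 := by
  classical
  suffices h : ∀ N f d, d.degree < N → coeff d (T f) = 0 by
    ext f d
    exact h _ f d (Nat.lt_succ_self _)
  intro N
  induction N with
  | zero => exact fun _ _ h => absurd h (Nat.not_lt_zero _)
  | succ N ih =>
    intro f d hd
    obtain ⟨g, hg⟩ := exists_eq_sum_X_mul Finset.univ (f - constantCoeff f • 1) fun d hd => by
      obtain rfl : d = 0 := Finsupp.ext fun i => hd i (Finset.mem_univ i)
      simp
    rw [sub_eq_iff_eq_add.1 hg, map_add, map_smul, h1, smul_zero, add_zero, map_sum, map_sum]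
    refine Finset.sum_eq_zero fun i _ => ?_
    rw [hX]
    by_cases hi : d i = 0
    · exact X_dvd_iff.1 (dvd_mul_right _ _) d hi
    · obtain ⟨e, rfl⟩ : ∃ e, d = Finsupp.single i 1 + e :=
        exists_add_of_le (Finsupp.single_le_iff.2 (Nat.one_le_iff_ne_zero.2 hi))
      rw [X, coeff_add_monomial_mul, one_mul]
      refine ih _ _ ?_
      rw [map_add, Finsupp.degree_single] at hd
      omega

end MvPowerSeries

namespace NCSF

/-! ## The two kinds of variables -/

theorem exists_powerSeries_eq_add_smul {K : Type*} [CommRing K] (f : K⟦X⟧) :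
    f = PowerSeries.C (PowerSeries.coeff 0 f) +
      PowerSeries.X * PowerSeries.mk fun m => PowerSeries.coeff (m + 1) f := by
  ext m
  cases m with
  | zero => simp
  | succ m => simp [PowerSeries.coeff_succ_X_mul]

theorem coeff_zero_mul {K : Type*} [CommRing K] (f g : K⟦X⟧) :
    PowerSeries.coeff 0 (f * g) = PowerSeries.coeff 0 f * PowerSeries.coeff 0 g := by
  simp

theorem map_one_eq_zero_of_leibniz {R B : Type*} [CommRing R] [Ring B] [Algebra R B]
    {D : B →ₗ[R] B} (hD : ∀ u v, D (u * v) = D u * v + u * D v) : D 1 = 0 := by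
  simpa using hD 1 1

/-! ### Noncommutative variables. -/

namespace NonComm

variable {K : Type*} [CommRing K] {n : ℕ}

/-- The two derivations agree at each `z_i`, so by the Leibniz rule their difference commutes with
multiplication by `z_i`; it also kills `1`. -/
theorem eq_bracket {R : Type*} [CommRing R] {D : NCSeries (Fin n) R →ₗ[R] NCSeries (Fin n) R}
    (hD : ∀ u v, D (u * v) = D u * v + u * D v) :
    D = NCSeries.bracket fun i => D (NCSeries.X i) := by
  rw [← sub_eq_zero]
  refine NCSeries.eq_zero_of_map_X_mul _ ?_ fun i f => ?_
  · rw [LinearMap.sub_apply, map_one_eq_zero_of_leibniz hD,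
      map_one_eq_zero_of_leibniz (NCSeries.bracket_mul _), sub_zero]
  · rw [LinearMap.sub_apply, LinearMap.sub_apply, hD, NCSeries.bracket_mul, NCSeries.bracket_X,
      mul_sub]
    abel

variable (K n) in
/-- Power series in noncommutative variables. -/
def seriesPair : SeriesPair K n (NCSeries (Fin n) K) (NCSeries (Fin n) K⟦X⟧) where
  incl := incl
  tCoeff := tCoeff
  tDeriv := tDeriv
  bracket := NCSeries.bracket
  bracketT := NCSeries.bracket
  var := NCSeries.X
  varT := NCSeries.X
  ext_tCoeff h := by
    ext1 w
    ext m
    exact congrFun (h m) w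
  tCoeff_incl m a := by
    ext1 w
    change PowerSeries.coeff m (PowerSeries.C (a w)) = _
    rw [PowerSeries.coeff_C]
    split_ifs <;> rfl
  exists_eq_add_smul u := ⟨fun w => PowerSeries.mk fun m => PowerSeries.coeff (m + 1) (u w), by
    ext1 w
    exact exists_powerSeries_eq_add_smul (u w)⟩
  tCoeff_zero_smul u := by
    ext1 w
    exact PowerSeries.coeff_zero_X_mul (u w)
  tCoeff_succ_smul m u := by
    ext1 w
    exact PowerSeries.coeff_succ_X_mul m (u w)
  tCoeff_zero_mul u v := by
    ext1 w
    change PowerSeries.coeff 0 ((u * v) w) = _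
    rw [NCSeries.mul_apply, NCSeries.mul_apply, map_sum]
    refine Finset.sum_congr rfl fun k _ => ?_
    exact coeff_zero_mul _ _
  tCoeff_tDeriv m u := by
    ext1 w
    change PowerSeries.coeff m (PowerSeries.derivative K (u w)) =
      (m + 1) • PowerSeries.coeff (m + 1) (u w)
    rw [PowerSeries.coeff_derivative, nsmul_eq_mul, mul_comm]
    push_cast
    rfl
  tDeriv_mul u v := by
    ext1 w
    change PowerSeries.derivative K ((u * v) w) = (tDeriv u * v) w + (u * tDeriv v) w
    simp only [NCSeries.mul_apply, map_sum, ← Finset.sum_add_distrib]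
    refine Finset.sum_congr rfl fun k _ => ?_
    rw [Derivation.leibniz, smul_eq_mul, smul_eq_mul, mul_comm (v _), add_comm]
    rfl
  tDeriv_smul c u := by
    ext1 w
    change PowerSeries.derivative K (c * u w) = PowerSeries.derivative K c * u w + c * _
    rw [Derivation.leibniz, smul_eq_mul, smul_eq_mul, mul_comm (u w), add_comm]
    rfl
  incl_one := by
    ext1 w
    cases w with
    | nil => exact map_one PowerSeries.C
    | cons j w => exact map_zero PowerSeries.C
  incl_mul a b := by
    ext1 w
    change PowerSeries.C ((a * b) w) = _
    rw [NCSeries.mul_apply, NCSeries.mul_apply, map_sum]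
    refine Finset.sum_congr rfl fun k _ => ?_
    rw [map_mul]
    rfl
  incl_var i := by
    ext1 w
    change PowerSeries.C (if w = [i] then 1 else 0) = if w = [i] then 1 else 0
    split_ifs <;> simp
  tCoeff_bracketT_incl m u a := by
    ext1 w
    change PowerSeries.coeff m (NCSeries.bracket u (incl a) w) = _
    simp only [NCSeries.bracket_apply, map_sum]
    refine Finset.sum_congr rfl fun k _ => Finset.sum_congr rfl fun l _ =>
      Finset.sum_congr rfl fun i _ => ?_
    exact PowerSeries.coeff_mul_C _ _ _
  eq_bracketT _ hD := eq_bracket hD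
  eq_id α h1 hm hX := by
    rw [← sub_eq_zero]
    refine NCSeries.eq_zero_of_map_X_mul _ (by simp [h1]) fun i f => ?_
    simp [hm, hX, mul_sub]

end NonComm

/-! ### Commutative variables. -/

namespace Comm

variable {K : Type*} [CommRing K] {n : ℕ}

section bracket

variable {R : Type*} [CommRing R]

theorem bracket_apply (u : Fin n → MvPowerSeries (Fin n) R) (a : MvPowerSeries (Fin n) R) :
    bracket u a = ∑ i, u i * MvPowerSeries.pderiv R i a := by
  change (∑ i, u i • MvPowerSeries.pderiv R i : Derivation R _ (MvPowerSeries (Fin n) R)) a = _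
  rw [← Derivation.coeFnAddMonoidHom_apply, map_sum, Finset.sum_apply]
  rfl

theorem bracket_mul (u : Fin n → MvPowerSeries (Fin n) R) (a b : MvPowerSeries (Fin n) R) :
    bracket u (a * b) = bracket u a * b + a * bracket u b := by
  simp only [bracket_apply, Derivation.leibniz, Finset.sum_mul, Finset.mul_sum,
    ← Finset.sum_add_distrib, smul_eq_mul]
  refine Finset.sum_congr rfl fun i _ => ?_
  ring

theorem bracket_X (u : Fin n → MvPowerSeries (Fin n) R) (i : Fin n) :
    bracket u (MvPowerSeries.X i) = u i := by
  simp [bracket_apply, MvPowerSeries.pderiv_X, Pi.single_apply]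

theorem eq_bracket {D : MvPowerSeries (Fin n) R →ₗ[R] MvPowerSeries (Fin n) R}
    (hD : ∀ u v, D (u * v) = D u * v + u * D v) :
    D = bracket fun i => D (MvPowerSeries.X i) := by
  rw [← sub_eq_zero]
  refine MvPowerSeries.eq_zero_of_map_X_mul _ ?_ fun i f => ?_
  · rw [LinearMap.sub_apply, map_one_eq_zero_of_leibniz hD,
      map_one_eq_zero_of_leibniz (bracket_mul _), sub_zero]
  · rw [LinearMap.sub_apply, LinearMap.sub_apply, hD, bracket_mul, bracket_X, mul_sub]
    abel

end bracket

theorem coeff_tCoeff (m : ℕ) (u : MvPowerSeries (Fin n) K⟦X⟧) (w : Fin n →₀ ℕ) :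
    MvPowerSeries.coeff w (tCoeff m u) = PowerSeries.coeff m (MvPowerSeries.coeff w u) := rfl

theorem coeff_tDeriv (u : MvPowerSeries (Fin n) K⟦X⟧) (w : Fin n →₀ ℕ) :
    MvPowerSeries.coeff w (tDeriv u) = PowerSeries.derivative K (MvPowerSeries.coeff w u) := rfl

theorem incl_eq_map (a : MvPowerSeries (Fin n) K) : incl a = MvPowerSeries.map PowerSeries.C a :=
  MvPowerSeries.ext fun _ => rfl

variable (K n) in
/-- Power series in commutative variables. -/
def seriesPair : SeriesPair K n (MvPowerSeries (Fin n) K) (MvPowerSeries (Fin n) K⟦X⟧) where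
  incl := incl
  tCoeff := tCoeff
  tDeriv := tDeriv
  bracket := bracket
  bracketT := bracket
  var := MvPowerSeries.X
  varT := MvPowerSeries.X
  ext_tCoeff h := by
    ext w m
    exact congrArg (MvPowerSeries.coeff w) (h m)
  tCoeff_incl m a := by
    ext w
    rw [coeff_tCoeff, incl_eq_map, MvPowerSeries.coeff_map, PowerSeries.coeff_C]
    split_ifs <;> simp
  exists_eq_add_smul u := by
    refine ⟨fun w => PowerSeries.mk fun m =>
      PowerSeries.coeff (m + 1) (MvPowerSeries.coeff w u), ?_⟩
    refine MvPowerSeries.ext fun w => ?_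
    exact exists_powerSeries_eq_add_smul (MvPowerSeries.coeff w u)
  tCoeff_zero_smul u := by
    ext w
    exact PowerSeries.coeff_zero_X_mul (MvPowerSeries.coeff w u)
  tCoeff_succ_smul m u := by
    ext w
    exact PowerSeries.coeff_succ_X_mul m (MvPowerSeries.coeff w u)
  tCoeff_zero_mul u v := by
    ext w
    rw [coeff_tCoeff, MvPowerSeries.coeff_mul, MvPowerSeries.coeff_mul, map_sum]
    refine Finset.sum_congr rfl fun k _ => ?_
    exact coeff_zero_mul _ _
  tCoeff_tDeriv m u := by
    ext w
    rw [map_nsmul, coeff_tCoeff, coeff_tCoeff, coeff_tDeriv, PowerSeries.coeff_derivative,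
      nsmul_eq_mul, mul_comm]
    push_cast
    rfl
  tDeriv_mul u v := by
    refine MvPowerSeries.ext fun w => ?_
    simp only [map_add, coeff_tDeriv, MvPowerSeries.coeff_mul, map_sum, ← Finset.sum_add_distrib]
    refine Finset.sum_congr rfl fun k _ => ?_
    rw [Derivation.leibniz, smul_eq_mul, smul_eq_mul, mul_comm (MvPowerSeries.coeff k.2 v),
      add_comm]
  tDeriv_smul c u := by
    refine MvPowerSeries.ext fun w => ?_
    change PowerSeries.derivative K (c * MvPowerSeries.coeff w u) =
      PowerSeries.derivative K c * MvPowerSeries.coeff w u +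
        c * PowerSeries.derivative K (MvPowerSeries.coeff w u)
    rw [Derivation.leibniz, smul_eq_mul, smul_eq_mul, mul_comm (MvPowerSeries.coeff w u), add_comm]
  incl_one := by rw [incl_eq_map, map_one]
  incl_mul a b := by simp only [incl_eq_map, map_mul]
  incl_var i := by rw [incl_eq_map, MvPowerSeries.map_X]
  tCoeff_bracketT_incl m u a := by
    ext w
    rw [coeff_tCoeff, bracket_apply, bracket_apply, map_sum, map_sum, map_sum]
    refine Finset.sum_congr rfl fun i _ => ?_
    rw [MvPowerSeries.coeff_mul, MvPowerSeries.coeff_mul, map_sum]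
    refine Finset.sum_congr rfl fun p _ => ?_
    rw [MvPowerSeries.coeff_pderiv, MvPowerSeries.coeff_pderiv, incl_eq_map,
      MvPowerSeries.coeff_map, coeff_tCoeff, ← map_natCast PowerSeries.C,
      ← map_one PowerSeries.C, ← map_add, ← map_mul, PowerSeries.coeff_mul_C]
  eq_bracketT _ hD := eq_bracket hD
  eq_id α h1 hm hX := by
    rw [← sub_eq_zero]
    refine MvPowerSeries.eq_zero_of_map_X_mul _ (by simp [h1]) fun i f => ?_
    simp [hm, hX, mul_sub]

/-- For commuting variables `[u ∂/∂z] H = JH · u`, so each step of the recursion multiplies by the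
Jacobian. -/
theorem jacobian_pow_mulVec (H : Fin n → MvPowerSeries (Fin n) K) (m : ℕ) :
    (jacobian H ^ m).mulVec H = Cvec H (m + 1) := by
  induction m with
  | zero => simp [Cvec]
  | succ m ih =>
    rw [pow_succ', ← Matrix.mulVec_mulVec, ih]
    funext i
    change _ = bracket (Cvec H (m + 1)) (H i)
    rw [bracket_apply, Matrix.mulVec, dotProduct]
    exact Finset.sum_congr rfl fun j _ => mul_comm (G := MvPowerSeries (Fin n) K) _ _

end Comm

end NCSF

end

theorem mainTheorem11 {K : Type*} [CommRing K] [Algebra ℚ K] (n m : ℕ) (hm : 1 ≤ m) :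
    -- noncommutative variables
    (∀ (H : Fin n → NCSeries (Fin n) K) (F : NCSF.NonComm.Aut n K),
      (∀ i, H i [] = 0) →
      (∀ i, F (NCSeries.X i) =
        NCSeries.X i - (PowerSeries.X : PowerSeries K) • NCSF.NonComm.incl (H i)) →
      ∀ i : Fin n,
        NCSF.NonComm.Cvec H m i = (-1 : K) ^ m • ∑ I : Composition m,
          ((-1 : K) ^ I.length * (NCSF.fp I.blocks : K)) •
            NCSF.cpow (NCSF.NonComm.lam F) I (NCSeries.X i) ∧
        NCSF.NonComm.Cvec H m i = (-1 : K) • ∑ I : Composition m,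
          ((-1 : K) ^ I.length * (NCSF.lp I.blocks : K)) •
            NCSF.cpow (NCSF.NonComm.s F) I (NCSeries.X i) ∧
        NCSF.NonComm.Cvec H m i = (-1 : K) • ∑ I : Composition m,
          algebraMap ℚ K (∑ J ∈ NCSF.coarsenings I,
            (-1 : ℚ) ^ J.length * ((NCSF.lp J.blocks : ℚ) / (NCSF.sp₂ I J : ℚ))) •
            NCSF.cpow (NCSF.NonComm.phi F) I (NCSeries.X i) ∧
        NCSF.NonComm.Cvec H m i = ∑ I : Composition m,
          algebraMap ℚ K (∑ J ∈ NCSF.coarsenings I,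
            (-1 : ℚ) ^ (J.length - 1) *
              ((NCSF.lp J.blocks : ℚ) / (NCSF.piU₂ I.reverse J.reverse : ℚ))) •
            NCSF.cpow (NCSF.NonComm.xi F) I (NCSeries.X i)) ∧
    -- commutative variables
    (∀ (H : Fin n → MvPowerSeries (Fin n) K) (F : NCSF.Comm.Aut n K),
      (∀ i, MvPowerSeries.constantCoeff (H i) = 0) →
      (∀ i, F (MvPowerSeries.X i) =
        MvPowerSeries.X i - (PowerSeries.X : PowerSeries K) • NCSF.Comm.incl (H i)) →
      ∀ i : Fin n,
        -- the formulas for `C_m(z)`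
        NCSF.Comm.Cvec H m i = (-1 : K) ^ m • ∑ I : Composition m,
          ((-1 : K) ^ I.length * (NCSF.fp I.blocks : K)) •
            NCSF.cpow (NCSF.Comm.lam F) I (MvPowerSeries.X i) ∧
        NCSF.Comm.Cvec H m i = (-1 : K) • ∑ I : Composition m,
          ((-1 : K) ^ I.length * (NCSF.lp I.blocks : K)) •
            NCSF.cpow (NCSF.Comm.s F) I (MvPowerSeries.X i) ∧
        NCSF.Comm.Cvec H m i = (-1 : K) • ∑ I : Composition m,
          algebraMap ℚ K (∑ J ∈ NCSF.coarsenings I,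
            (-1 : ℚ) ^ J.length * ((NCSF.lp J.blocks : ℚ) / (NCSF.sp₂ I J : ℚ))) •
            NCSF.cpow (NCSF.Comm.phi F) I (MvPowerSeries.X i) ∧
        NCSF.Comm.Cvec H m i = ∑ I : Composition m,
          algebraMap ℚ K (∑ J ∈ NCSF.coarsenings I,
            (-1 : ℚ) ^ (J.length - 1) *
              ((NCSF.lp J.blocks : ℚ) / (NCSF.piU₂ I.reverse J.reverse : ℚ))) •
            NCSF.cpow (NCSF.Comm.xi F) I (MvPowerSeries.X i) ∧
        -- the formulas for `(JH)^{m-1} H`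
        ((NCSF.Comm.jacobian H) ^ (m - 1)).mulVec H i = (-1 : K) ^ m • ∑ I : Composition m,
          ((-1 : K) ^ I.length * (NCSF.fp I.blocks : K)) •
            NCSF.cpow (NCSF.Comm.lam F) I (MvPowerSeries.X i) ∧
        ((NCSF.Comm.jacobian H) ^ (m - 1)).mulVec H i = (-1 : K) • ∑ I : Composition m,
          ((-1 : K) ^ I.length * (NCSF.lp I.blocks : K)) •
            NCSF.cpow (NCSF.Comm.s F) I (MvPowerSeries.X i) ∧
        ((NCSF.Comm.jacobian H) ^ (m - 1)).mulVec H i = (-1 : K) • ∑ I : Composition m,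
          algebraMap ℚ K (∑ J ∈ NCSF.coarsenings I,
            (-1 : ℚ) ^ J.length * ((NCSF.lp J.blocks : ℚ) / (NCSF.sp₂ I J : ℚ))) •
            NCSF.cpow (NCSF.Comm.phi F) I (MvPowerSeries.X i) ∧
        ((NCSF.Comm.jacobian H) ^ (m - 1)).mulVec H i = ∑ I : Composition m,
          algebraMap ℚ K (∑ J ∈ NCSF.coarsenings I,
            (-1 : ℚ) ^ (J.length - 1) *
              ((NCSF.lp J.blocks : ℚ) / (NCSF.piU₂ I.reverse J.reverse : ℚ))) •
            NCSF.cpow (NCSF.Comm.xi F) I (MvPowerSeries.X i)) := by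
  obtain ⟨k, rfl⟩ : ∃ k, m = k + 1 := ⟨m - 1, by omega⟩
  constructor
  · intro H F _ hF i
    have h := NCSF.SeriesPair.formulas_op_twist (P := NCSF.NonComm.seriesPair K n) hF k
    -- The coefficient of `t^k` in the twist is `C_{k+1}`, so the sequence is shifted to start at
    -- `H`.
    have hC := NCSF.SeriesPair.op_twist_var (P := NCSF.NonComm.seriesPair K n) hF
      (C := fun j => NCSF.NonComm.Cvec H (j + 1)) rfl (fun _ _ => rfl) k i
    obtain ⟨h1, h2, h3, h4⟩ := h.apply_var hC
    exact ⟨h1, h2, h3, h4⟩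
  · intro H F _ hF i
    have h := NCSF.SeriesPair.formulas_op_twist (P := NCSF.Comm.seriesPair K n) hF k
    have hC := NCSF.SeriesPair.op_twist_var (P := NCSF.Comm.seriesPair K n) hF
      (C := fun j => NCSF.Comm.Cvec H (j + 1)) rfl (fun _ _ => rfl) k i
    rw [Nat.add_sub_cancel, NCSF.Comm.jacobian_pow_mulVec]
    obtain ⟨h1, h2, h3, h4⟩ := h.apply_var hC
    exact ⟨h1, h2, h3, h4, h1, h2, h3, h4⟩
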